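/- **Theorem (Path Murnaghan–Nakayama Rule).** Symmetric functions are formal power series over $\mathbb{C}$ in variables $x_1,x_2,\dots$; let $p_k=\sum_i x_i^k$ ($k\ge 1$) be the power sums, and let the Schur function $s_\lambda$ be the limit as $N\to\infty$ of the Schur polynomials $s_\lambda(x_1,\dots,x_N)=\frac{\sum_{w\in\mathfrak{S}_N}\mathrm{sign}(w)\,w\cdot x^{\lambda+\delta}}{\sum_{w\in\mathfrak{S}_N}\mathrm{sign}(w)\,w\cdot x^{\delta}}$, $\delta=(N-1,\dots,1,0)$. Let $\mu=(\mu_1\ge\dots\ge\mu_r)$ be a partition of $n$ with $r$ positive parts. Let $I=(i_1,\dots,i_k)$ and $J=(j_1,\dots,j_k)$ be lists of distinct elements of $\{1,\dots,n\}$ such that the directed graph on $\{1,\dots,n\}$ with edges $i_1\to j_1,\dots,i_k\to j_k$ is a disjoint union of directed paths with $\mu_1,\dots,\mu_r$ vertices. The path power sum of $\mu$ is $$\vec p_\mu := n!\cdot \mathrm{ch}_n(R\,\mathbf 1_{IJ}),$$ where $\mathbf 1_{IJ}:\mathfrak{S}_n\to\{0,1\}$ is the indicator function of $\{w : w(i_t)=j_t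 \text{ for all } t\}$, $(Rf)(w)=\frac1{n!}\sum_{v\in\mathfrak{S}_n} f(vwv^{-1})$, and $\mathrm{ch}_n(f)=\frac1{n!}\sum_{w\in\mathfrak{S}_n} f(w)\prod_{C \text{ cycle of } w}p_{|C|}$ (fixed points count as cycles); it does not depend on the choice of $(I,J)$. A *ribbon* $\xi$ is a nonempty edgewise connected skew shape containing no $2\times2$ square; its sign is $(-1)^{h-1}$ with $h$ the number of rows it occupies, and its *tail* is its southwesternmost cell (English notation). A *monotonic ribbon tiling* $T$ of a partition $\lambda=\mathrm{shape}(T)$ is a disjoint decomposition $\lambda=\xi^{(1)}\sqcup\dots\sqcup\xi^{(r)}$ of its Young diagram into ribbons whose tails lie in columns $c_1<\dots<c_r$ and such that $\xi^{(1)}\sqcup\dots\sqcup\xi^{(i)}$ is the Young diagram of a partition for $0\le i\le r$; $\mathrm{sign}(T)$ is the product of the signs of its ribbons. Then, with $\mu_C=\sum_{i\in C}\mu_i$ and $m(\mu)!=\prod_{i\ge1}m_i(\mu)!$, where $m_i(\mu)$ is the multiplicity of $i$ as a part of $\mu$, $$\vec p_\mu=\sum_{\sigma\in\mathfrak{S}_r}\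 \prod_{C\text{ cycle of }\sigma}p_{\mu_C}\qquad\text{and}\qquad \vec p_\mu=m(\mu)!\cdot\sum_T\mathrm{sign}(T)\cdot s_{\mathrm{shape}(T)},$$ where the last sum is over all monotonic ribbon tilings $T$ with $r$ ribbons whose sizes $(|\xi^{(1)}|,\dots,|\xi^{(r)}|)$ form a rearrangement of $(\mu_1,\dots,\mu_r)$. -/

import Mathlib

open Finset

namespace PathMN

noncomputable section

/-! ### Symmetric functions

Symmetric functions are elements of the ring `MvPowerSeries ℕ ℂ` of formal power series in the
variables `x₀, x₁, x₂, …`. -/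

open Classical in
/-- The power sum `p_k = ∑ i, x_i ^ k` (for `k ≥ 1`). -/
def powerSum (k : ℕ) : MvPowerSeries ℕ ℂ :=
  fun m => if ∃ i : ℕ, m = Finsupp.single i k then 1 else 0

/-- The alternating polynomial `ε · x^a = ∑_w sign(w) ∏_j x_{w(j)}^{a_j}` in `N` variables. -/
def alternant (N : ℕ) (a : Fin N → ℕ) : MvPolynomial (Fin N) ℂ :=
  Matrix.det (Matrix.of fun i j : Fin N => (MvPolynomial.X i : MvPolynomial (Fin N) ℂ) ^ a j)

/-- The staircase `δ = (N-1, …, 1, 0)`. -/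
def staircase (N : ℕ) : Fin N → ℕ := fun j => N - 1 - (j : ℕ)

theorem alternant_staircase (N : ℕ) :
    alternant N (staircase N) =
      ∏ q ∈ (univ : Finset (Fin N × Fin N)).filter (fun q => q.1 < q.2),
        (MvPolynomial.X q.1 - MvPolynomial.X q.2 : MvPolynomial (Fin N) ℂ) := by
  have h := Matrix.det_projVandermonde (R := MvPolynomial (Fin N) ℂ) (n := N)
    (fun _ => 1) (fun i => MvPolynomial.X i)
  have h2 : alternant N (staircase N) = (Matrix.projVandermonde (R := MvPolynomial (Fin N) ℂ)
      (fun _ : Fin N => 1) (fun i => MvPolynomial.X i)).det := by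
    unfold alternant staircase
    congr 1
    ext1 i j
    simp [Matrix.projVandermonde, Matrix.rectVandermonde, Fin.val_rev, Nat.sub_sub,
      Nat.add_comm]
  rw [h2, h, Finset.prod_finset_product'
    ((univ : Finset (Fin N × Fin N)).filter (fun q => q.1 < q.2)) univ (fun i => Ioi i)
    (by simp) (f := fun i j => (MvPolynomial.X i - MvPolynomial.X j : MvPolynomial (Fin N) ℂ))]
  simp

theorem X_sub_X_dvd_alternant (N : ℕ) (a : Fin N → ℕ) {i j : Fin N} (hij : i ≠ j) :
    (MvPolynomial.X i - MvPolynomial.X j : MvPolynomial (Fin N) ℂ) ∣ alternant N a := by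
  rw [← Ideal.mem_span_singleton, ← Ideal.Quotient.eq_zero_iff_mem, alternant, RingHom.map_det]
  apply Matrix.det_zero_of_row_eq hij
  have h : Ideal.Quotient.mk (Ideal.span
      {(MvPolynomial.X i - MvPolynomial.X j : MvPolynomial (Fin N) ℂ)}) (MvPolynomial.X i) =
      Ideal.Quotient.mk _ (MvPolynomial.X j) := by
    rw [Ideal.Quotient.mk_eq_mk_iff_sub_mem]
    exact Ideal.mem_span_singleton_self _
  funext k
  simp [h]

theorem irreducible_X_sub_X {N : ℕ} {i j : Fin N} (hij : i ≠ j) :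
    Irreducible (MvPolynomial.X i - MvPolynomial.X j : MvPolynomial (Fin N) ℂ) := by
  have hc : MvPolynomial.coeff (Finsupp.single i 1)
      (MvPolynomial.X i - MvPolynomial.X j : MvPolynomial (Fin N) ℂ) = 1 := by
    rw [MvPolynomial.coeff_sub, MvPolynomial.coeff_X, MvPolynomial.coeff_X, if_pos rfl, if_neg,
      sub_zero]
    rw [Finsupp.single_left_inj one_ne_zero]
    exact hij.symm
  apply MvPolynomial.irreducible_of_totalDegree_eq_one
  · apply le_antisymm
    · refine (MvPolynomial.totalDegree_sub _ _).trans ?_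
      simp
    · have := MvPolynomial.le_totalDegree (p := (MvPolynomial.X i - MvPolynomial.X j :
        MvPolynomial (Fin N) ℂ)) (s := Finsupp.single i 1)
        (by rw [MvPolynomial.mem_support_iff, hc]; exact one_ne_zero)
      simpa using this
  · intro x hx
    have := hx (Finsupp.single i 1)
    rw [hc] at this
    exact isUnit_of_dvd_one this

/-- The Vandermonde determinant divides every alternating polynomial `ε · x^a`. -/
theorem alternant_staircase_dvd (N : ℕ) (a : Fin N → ℕ) :
    alternant N (staircase N) ∣ alternant N a := by
  rw [alternant_staircase]
  apply Finset.prod_dvd_of_isRelPrime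
  · rintro ⟨i, j⟩ hij ⟨k, l⟩ hkl hne
    simp only [coe_filter, mem_univ, true_and, Set.mem_ofPred_eq] at hij hkl
    refine ((irreducible_X_sub_X hij.ne).isRelPrime_iff_not_dvd).2 ?_
    rintro ⟨c, hc⟩
    have h := congrArg (MvPolynomial.eval
      (fun t : Fin N => if t = i then ((j : ℕ) : ℂ) else ((t : ℕ) : ℂ))) hc
    simp only [map_sub, map_mul, MvPolynomial.eval_X] at h
    rw [if_true, if_neg hij.ne', sub_self, zero_mul, sub_eq_zero] at h
    apply hne
    split_ifs at h with h1 h2 h2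
    · omega
    · have h3 : j = l := Fin.ext (by exact_mod_cast h)
      rw [h1, h3]
    · have h3 : k = j := Fin.ext (by exact_mod_cast h)
      omega
    · have h3 : k = l := Fin.ext (by exact_mod_cast h)
      omega
  · rintro ⟨i, j⟩ hij
    simp only [mem_filter, mem_univ, true_and] at hij
    exact X_sub_X_dvd_alternant N a hij.ne

theorem alternant_staircase_ne_zero (N : ℕ) : alternant N (staircase N) ≠ 0 := by
  rw [alternant_staircase]
  refine Finset.prod_ne_zero_iff.2 ?_
  rintro ⟨i, j⟩ hij
  simp only [mem_filter, mem_univ, true_and] at hij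
  exact (irreducible_X_sub_X hij.ne).ne_zero

/-- The exponent sequence `lam + δ` of length `N`. -/
def shiftedParts (N : ℕ) (lam : YoungDiagram) : Fin N → ℕ :=
  fun j => lam.rowLen j + staircase N j

/-- The Schur polynomial `s_lam(x_1, …, x_N) = (ε · x^(lam + δ)) / (ε · x^δ)`, for a partition
`lam` with at most `N` parts. -/
def schurPoly (N : ℕ) (lam : YoungDiagram) : MvPolynomial (Fin N) ℂ :=
  (alternant_staircase_dvd N (shiftedParts N lam)).choose

theorem alternant_mul_schurPoly (N : ℕ) (lam : YoungDiagram) :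
    alternant N (staircase N) * schurPoly N lam = alternant N (shiftedParts N lam) :=
  (alternant_staircase_dvd N (shiftedParts N lam)).choose_spec.symm

/-- The Schur function `s_lam`, the limit of the Schur polynomials `s_lam(x_1, …, x_N)` as
`N → ∞`: the coefficient at a monomial `m` is the one in `s_lam(x_1, …, x_N)`, with `N` so large
that `lam` has at most `N` parts and `m` only involves the first `N` variables. The choice of
such an `N` does not matter, see `coeff_schurFunction`. -/
def schurFunction (lam : YoungDiagram) : MvPowerSeries ℕ ℂ :=
  fun m => MvPolynomial.coeff m
    (MvPolynomial.rename (fun i : Fin (max (lam.colLen 0) (m.support.sup Nat.succ)) => (i : ℕ))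
      (schurPoly (max (lam.colLen 0) (m.support.sup Nat.succ)) lam))

/-- Setting the last variable to zero. -/
def killLast (N : ℕ) : MvPolynomial (Fin (N + 1)) ℂ →ₐ[ℂ] MvPolynomial (Fin N) ℂ :=
  MvPolynomial.aeval (Fin.lastCases 0 MvPolynomial.X)

theorem killLast_alternant (N : ℕ) (a : Fin (N + 1) → ℕ) (b : Fin N → ℕ)
    (hlast : a (Fin.last N) = 0) (h : ∀ j : Fin N, a j.castSucc = b j + 1) :
    killLast N (alternant (N + 1) a) = (∏ i, MvPolynomial.X i) * alternant N b := by
  unfold alternant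
  rw [AlgHom.map_det, Matrix.det_succ_row _ (Fin.last N), Fin.sum_univ_castSucc,
    ← Matrix.det_mul_column]
  have h0 : ∀ j : Fin N, (killLast N).mapMatrix (Matrix.of fun i j : Fin (N + 1) =>
      (MvPolynomial.X i : MvPolynomial (Fin (N + 1)) ℂ) ^ a j) (Fin.last N) j.castSucc = 0 := by
    intro j
    simp [killLast, h]
  simp only [h0, mul_zero, zero_mul, Finset.sum_const_zero, zero_add]
  rw [show (killLast N).mapMatrix (Matrix.of fun i j : Fin (N + 1) =>
      (MvPolynomial.X i : MvPolynomial (Fin (N + 1)) ℂ) ^ a j) (Fin.last N) (Fin.last N) = 1 by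
    simp [hlast]]
  rw [Even.neg_one_pow ⟨_, rfl⟩, one_mul, one_mul]
  congr 1
  ext1 i j
  simp [killLast, h, pow_succ']

/-- Stability: `s_lam(x_1, …, x_N, 0) = s_lam(x_1, …, x_N)` if `lam` has at most `N` parts. -/
theorem killLast_schurPoly {N : ℕ} {lam : YoungDiagram} (hN : lam.colLen 0 ≤ N) :
    killLast N (schurPoly (N + 1) lam) = schurPoly N lam := by
  have hz : lam.rowLen N = 0 := by
    by_contra h
    have h1 : (N, 0) ∈ lam := YoungDiagram.mem_iff_lt_rowLen.2 (Nat.pos_of_ne_zero h)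
    exact absurd (YoungDiagram.mem_iff_lt_colLen.1 h1) (not_lt.2 hN)
  have h1 : killLast N (alternant (N + 1) (staircase (N + 1))) =
      (∏ i, MvPolynomial.X i) * alternant N (staircase N) := by
    apply killLast_alternant
    · simp [staircase]
    · intro j
      have := j.isLt
      simp only [staircase, Fin.val_castSucc]
      omega
  have h2 : killLast N (alternant (N + 1) (shiftedParts (N + 1) lam)) =
      (∏ i, MvPolynomial.X i) * alternant N (shiftedParts N lam) := by
    apply killLast_alternant
    · simp [shiftedParts, staircase, hz]
    · intro j
      have := j.isLt
      simp only [shiftedParts, staircase, Fin.val_castSucc]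
      omega
  have h3 := congrArg (killLast N) (alternant_mul_schurPoly (N + 1) lam)
  rw [map_mul, h1, h2, ← alternant_mul_schurPoly, ← mul_assoc] at h3
  refine mul_left_cancel₀ ?_ h3
  exact mul_ne_zero (Finset.prod_ne_zero_iff.2 fun i _ => MvPolynomial.X_ne_zero i)
    (alternant_staircase_ne_zero N)

theorem coeff_rename_killLast (N : ℕ) (m : ℕ →₀ ℕ) (hm : m N = 0)
    (f : MvPolynomial (Fin (N + 1)) ℂ) :
    MvPolynomial.coeff m (MvPolynomial.rename (fun i : Fin N => (i : ℕ)) (killLast N f)) =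
      MvPolynomial.coeff m (MvPolynomial.rename (fun i : Fin (N + 1) => (i : ℕ)) f) := by
  induction f using MvPolynomial.induction_on' with
  | monomial u c =>
    rw [MvPolynomial.rename_monomial, killLast, MvPolynomial.aeval_monomial,
      Finsupp.prod_fintype _ _ (fun i => by simp), Fin.prod_univ_castSucc]
    by_cases hu : u (Fin.last N) = 0
    · have key : MvPolynomial.rename (fun i : Fin N => (i : ℕ))
          ((algebraMap ℂ (MvPolynomial (Fin N) ℂ)) c *
            ((∏ i : Fin N, (MvPolynomial.X i : MvPolynomial (Fin N) ℂ) ^ u i.castSucc) * 1)) =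
          MvPolynomial.rename (fun i : Fin (N + 1) => (i : ℕ)) (MvPolynomial.monomial u c) := by
        rw [MvPolynomial.monomial_eq, Finsupp.prod_fintype _ _ (fun i => by simp),
          Fin.prod_univ_castSucc]
        simp [hu, MvPolynomial.algebraMap_eq]
      rw [← MvPolynomial.rename_monomial, ← key]
      simp [hu]
    · rw [MvPolynomial.coeff_monomial, if_neg]
      · simp [hu]
      · intro h
        apply hu
        have h1 := DFunLike.congr_fun h N
        rw [hm] at h1
        have h2 := Finsupp.mapDomain_apply (f := fun i : Fin (N + 1) => (i : ℕ))
          Fin.val_injective u (Fin.last N)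
        simp only [Fin.val_last] at h2
        rw [← h2, h1]
  | add p q hp hq => simp only [map_add, MvPolynomial.coeff_add, hp, hq]

/-- The coefficients of the Schur function are those of the Schur polynomials in all sufficiently
many variables. -/
theorem coeff_schurFunction (lam : YoungDiagram) (m : ℕ →₀ ℕ) (N : ℕ) (hN : lam.colLen 0 ≤ N)
    (hm : ∀ i, N ≤ i → m i = 0) :
    MvPowerSeries.coeff m (schurFunction lam) =
      MvPolynomial.coeff m
        (MvPolynomial.rename (fun i : Fin N => (i : ℕ)) (schurPoly N lam)) := by
  have hle : max (lam.colLen 0) (m.support.sup Nat.succ) ≤ N := by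
    refine max_le hN (Finset.sup_le fun i hi => ?_)
    by_contra h
    exact (Finsupp.mem_support_iff.1 hi) (hm i (by simpa using h))
  have h0 : MvPowerSeries.coeff m (schurFunction lam) = MvPolynomial.coeff m
    (MvPolynomial.rename (fun i : Fin (max (lam.colLen 0) (m.support.sup Nat.succ)) => (i : ℕ))
      (schurPoly (max (lam.colLen 0) (m.support.sup Nat.succ)) lam)) := rfl
  rw [h0]
  clear hm h0 hN
  induction N, hle using Nat.le_induction with
  | base => rfl
  | succ N hle ih =>
    rw [ih, ← killLast_schurPoly ((le_max_left _ _).trans hle), coeff_rename_killLast]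
    by_contra h
    have h1 : N + 1 ≤ m.support.sup Nat.succ :=
      Finset.le_sup (f := Nat.succ) (Finsupp.mem_support_iff.2 h)
    have h2 := (le_max_right (lam.colLen 0) (m.support.sup Nat.succ)).trans hle
    omega

/-! ### Partial permutations, atomic symmetric functions and path power sums -/

/-- A partial permutation `(I, J)` of size `k` of an `n`-element set: two lists of length `k` with
distinct entries, thought of as the partial map `I t ↦ J t`. -/
structure PartialPerm (n k : ℕ) where
  I : Fin k → Fin n
  J : Fin k → Fin n
  I_injective : Function.Injective I
  J_injective : Function.Injective J

/-- The indicator function `1_{IJ}` of the permutations `w` with `w(I) = J`. -/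
def PartialPerm.indicator {n k : ℕ} (P : PartialPerm n k) (w : Equiv.Perm (Fin n)) : ℂ :=
  if ∀ t, w (P.I t) = P.J t then 1 else 0

/-- The Reynolds operator, averaging a function on the symmetric group over conjugation. -/
def reynolds {n : ℕ} (f : Equiv.Perm (Fin n) → ℂ) (w : Equiv.Perm (Fin n)) : ℂ :=
  (1 / (n.factorial : ℂ)) * ∑ v : Equiv.Perm (Fin n), f (v * w * v⁻¹)

/-- The characteristic map `ch_n(f) = (1/n!) ∑_w f(w) p_{λ(w)}`, where `λ(w)` is the cycle type of
`w` (fixed points included). -/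
def frobeniusCh {n : ℕ} (f : Equiv.Perm (Fin n) → ℂ) : MvPowerSeries ℕ ℂ :=
  (1 / (n.factorial : ℂ)) •
    ∑ w : Equiv.Perm (Fin n), f w • (w.partition.parts.map powerSum).prod

/-- The atomic symmetric function `A_{n,I,J} = n! · ch_n(R 1_{IJ})`. -/
def PartialPerm.atomic {n k : ℕ} (P : PartialPerm n k) : MvPowerSeries ℕ ℂ :=
  (n.factorial : ℂ) • frobeniusCh (reynolds P.indicator)

/-- The graph of the partial permutation `(I, J)`, with vertex set `Fin n` and the edges
`I t → J t`, is a disjoint union of directed paths with `μ 0, μ 1, …` vertices: `e ⟨i, j⟩` is the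
`j`-th vertex of the `i`-th path. -/
def PartialPerm.IsDisjointPaths {n k r : ℕ} (P : PartialPerm n k) (μ : Fin r → ℕ) : Prop :=
  ∃ e : (Σ i : Fin r, Fin (μ i)) ≃ Fin n, ∀ a b : Σ i : Fin r, Fin (μ i),
    (∃ t, P.I t = e a ∧ P.J t = e b) ↔ a.1 = b.1 ∧ (b.2 : ℕ) = a.2 + 1

/-- The vertices of the disjoint union of paths that are not the last one of their path. -/
abbrev NonLast {r : ℕ} (μ : Fin r → ℕ) : Type :=
  {a : Σ i : Fin r, Fin (μ i) // (a.2 : ℕ) + 1 < μ a.1}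

/-- The next vertex on the same path. -/
def NonLast.next {r : ℕ} {μ : Fin r → ℕ} (a : NonLast μ) : Σ i : Fin r, Fin (μ i) :=
  ⟨a.1.1, ⟨a.1.2 + 1, a.2⟩⟩

/-- A partial permutation whose graph consists of disjoint paths of sizes `μ 0, μ 1, …`, on
consecutive intervals of vertices. -/
def pathPartialPerm {r : ℕ} (μ : Fin r → ℕ) :
    PartialPerm (∑ i, μ i) (Fintype.card (NonLast μ)) where
  I t := finSigmaFinEquiv ((Fintype.equivFin (NonLast μ)).symm t).1
  J t := finSigmaFinEquiv (NonLast.next ((Fintype.equivFin (NonLast μ)).symm t))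
  I_injective := by
    intro s t h
    exact (Fintype.equivFin (NonLast μ)).symm.injective
      (Subtype.ext (finSigmaFinEquiv.injective h))
  J_injective := by
    intro s t h
    have h' := finSigmaFinEquiv.injective h
    apply (Fintype.equivFin (NonLast μ)).symm.injective
    generalize (Fintype.equivFin (NonLast μ)).symm s = a at h'
    generalize (Fintype.equivFin (NonLast μ)).symm t = b at h'
    obtain ⟨⟨i, j⟩, ha⟩ := a
    obtain ⟨⟨i', j'⟩, hb⟩ := b
    simp only [NonLast.next, Sigma.mk.injEq] at h'
    obtain ⟨rfl, h2⟩ := h'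
    have h3 := congrArg Fin.val (eq_of_heq h2)
    have h4 : j = j' := Fin.ext (by simpa using h3)
    subst h4
    rfl

theorem pathPartialPerm_isDisjointPaths {r : ℕ} (μ : Fin r → ℕ) :
    (pathPartialPerm μ).IsDisjointPaths μ := by
  refine ⟨finSigmaFinEquiv, fun a b => ⟨?_, ?_⟩⟩
  · rintro ⟨t, h1, h2⟩
    have h1' := finSigmaFinEquiv.injective h1
    have h2' := finSigmaFinEquiv.injective h2
    rw [← h2', ← h1']
    exact ⟨rfl, rfl⟩
  · obtain ⟨i, j⟩ := a
    obtain ⟨i', j'⟩ := b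
    rintro ⟨h1, h2⟩
    dsimp only at h1 h2
    subst h1
    refine ⟨Fintype.equivFin (NonLast μ) ⟨⟨i, j⟩, by dsimp only; rw [← h2]; exact j'.isLt⟩,
      ?_, ?_⟩
    · simp [pathPartialPerm]
    · obtain ⟨j', hj'⟩ := j'
      dsimp only at h2
      subst h2
      simp only [pathPartialPerm, Equiv.symm_apply_apply]
      rfl

/-- The path power sum of `μ = (μ 0, μ 1, …)`: the atomic symmetric function of a partial
permutation whose graph consists of disjoint paths of sizes `μ 0, μ 1, …`. All such partial
permutations give the same symmetric function, see `atomic_eq_pathPowerSum`. -/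
def pathPowerSum {r : ℕ} (μ : Fin r → ℕ) : MvPowerSeries ℕ ℂ :=
  (pathPartialPerm μ).atomic

theorem reynolds_conj {n : ℕ} (f g : Equiv.Perm (Fin n) → ℂ) (u : Equiv.Perm (Fin n))
    (h : ∀ w, g w = f (u * w * u⁻¹)) : reynolds g = reynolds f := by
  funext w
  unfold reynolds
  congr 1
  rw [← Equiv.sum_comp (Equiv.mulLeft u) (fun v => f (v * w * v⁻¹))]
  refine Finset.sum_congr rfl fun v _ => ?_
  rw [h]
  simp [mul_assoc]

/-- The path power sum does not depend on the choice of the partial permutation. -/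
theorem atomic_eq_pathPowerSum {n k r : ℕ} (μ : Fin r → ℕ) (P : PartialPerm n k)
    (hP : P.IsDisjointPaths μ) : P.atomic = pathPowerSum μ := by
  obtain ⟨e, he⟩ := hP
  obtain ⟨e', he'⟩ := pathPartialPerm_isDisjointPaths μ
  unfold pathPowerSum
  generalize pathPartialPerm μ = Q at he'
  have hn : ∑ i, μ i = n := by
    have := Fintype.card_congr (e'.symm.trans e)
    simpa using this
  generalize Fintype.card (NonLast μ) = k' at Q
  revert Q e'
  rw [hn]
  intro e' Q he'
  unfold PartialPerm.atomic
  rw [reynolds_conj Q.indicator P.indicator (e.symm.trans e')]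
  intro w
  unfold PartialPerm.indicator
  have key : ∀ {l : ℕ} (R : PartialPerm n l) (f : (Σ i : Fin r, Fin (μ i)) ≃ Fin n)
      (_ : ∀ a b : Σ i : Fin r, Fin (μ i),
        (∃ t, R.I t = f a ∧ R.J t = f b) ↔ a.1 = b.1 ∧ (b.2 : ℕ) = a.2 + 1)
      (x : Equiv.Perm (Fin n)),
      (∀ t, x (R.I t) = R.J t) ↔ ∀ a b : Σ i : Fin r, Fin (μ i),
        a.1 = b.1 ∧ (b.2 : ℕ) = a.2 + 1 → x (f a) = f b := by
    intro l R f hf x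
    constructor
    · rintro h a b hab
      obtain ⟨t, h1, h2⟩ := (hf a b).2 hab
      rw [← h1, ← h2, h t]
    · intro h t
      have := h (f.symm (R.I t)) (f.symm (R.J t))
        ((hf _ _).1 ⟨t, by simp, by simp⟩)
      simpa using this
  have hiff : (∀ t, w (P.I t) = P.J t) ↔
      ∀ t, ((e.symm.trans e' : Equiv.Perm (Fin n)) * w *
        (e.symm.trans e' : Equiv.Perm (Fin n))⁻¹) (Q.I t) = Q.J t := by
    rw [key P e he, key Q e' he']
    refine forall_congr' fun a => forall_congr' fun b => imp_congr_right fun _ => ?_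
    simp [Equiv.Perm.mul_apply, Equiv.Perm.inv_def, Equiv.symm_apply_eq]
  simp only [hiff]

/-- The cycles of a permutation, as sets; fixed points are cycles of length one. -/
def permCycles {r : ℕ} (σ : Equiv.Perm (Fin r)) : Finset (Finset (Fin r)) :=
  univ.image fun i => univ.filter fun j => σ.SameCycle i j

/-- `m(μ)! = m_1(μ)! m_2(μ)! ⋯`, where `m_i(μ)` is the multiplicity of `i ≥ 1` as a part of
`μ`. -/
def multFactorial {r : ℕ} (μ : Fin r → ℕ) : ℕ :=
  ∏ i ∈ Icc 1 (∑ j, μ j), (#{j | μ j = i}).factorial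

/-! ### Ribbons and monotonic ribbon tilings

Cells `(i, j) : ℕ × ℕ` are given by their row `i` and column `j`, in English notation. -/

/-- A ribbon is an edgewise connected skew shape that contains no `2 × 2` square. Two cells share
an edge if and only if one covers the other in the product order of `ℕ × ℕ`; connected graphs are
nonempty. -/
structure IsRibbon (S : Finset (ℕ × ℕ)) : Prop where
  skew : ∃ lam nu : YoungDiagram, nu ≤ lam ∧ S = lam.cells \ nu.cells
  connected : ((SimpleGraph.hasse (ℕ × ℕ)).induce (S : Set (ℕ × ℕ))).Connected
  no_square : ∀ i j : ℕ, ¬ ((i, j) ∈ S ∧ (i + 1, j) ∈ S ∧ (i, j + 1) ∈ S ∧ (i + 1, j + 1) ∈ S)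

/-- The sign `(-1)^ht` of a ribbon, its height `ht` being the number of rows it occupies minus
one. -/
def ribbonSign (S : Finset (ℕ × ℕ)) : ℤ := (-1) ^ (#(S.image Prod.fst) - 1)

/-- `c` is the tail of `S`, its southwesternmost cell. -/
def IsTail (S : Finset (ℕ × ℕ)) (c : ℕ × ℕ) : Prop :=
  c ∈ S ∧ ∀ d ∈ S, d.1 ≤ c.1 ∧ c.2 ≤ d.2

/-- A monotonic ribbon tiling with `r` ribbons: a disjoint decomposition of the Young diagram
`shape` into ribbons whose tails occupy columns `c_1 < ⋯ < c_r`, each initial union of which is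
the Young diagram of a partition. -/
@[ext]
structure MonotonicRibbonTiling (r : ℕ) where
  shape : YoungDiagram
  ribbon : Fin r → Finset (ℕ × ℕ)
  isRibbon : ∀ i, IsRibbon (ribbon i)
  disjoint : ∀ i j, i ≠ j → Disjoint (ribbon i) (ribbon j)
  union_eq : univ.biUnion ribbon = shape.cells
  tails : ∃ c : Fin r → ℕ × ℕ, (∀ i, IsTail (ribbon i) (c i)) ∧ StrictMono fun i => (c i).2
  initial : ∀ k ≤ r, ∃ nu : YoungDiagram,
    (univ.filter fun i : Fin r => (i : ℕ) < k).biUnion ribbon = nu.cells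

/-- The sign of a tiling is the product of the signs of its ribbons. -/
def MonotonicRibbonTiling.sign {r : ℕ} (T : MonotonicRibbonTiling r) : ℤ :=
  ∏ i, ribbonSign (T.ribbon i)

/-- The ribbon sizes of `T` are a rearrangement of `μ`. -/
def MonotonicRibbonTiling.HasSizes {r : ℕ} (T : MonotonicRibbonTiling r) (μ : Fin r → ℕ) : Prop :=
  ∃ w : Equiv.Perm (Fin r), ∀ i, #(T.ribbon i) = μ (w i)

theorem finite_hasSizes {r : ℕ} (μ : Fin r → ℕ) :
    {T : MonotonicRibbonTiling r | T.HasSizes μ}.Finite := by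
  have hinj : Function.Injective (fun T : MonotonicRibbonTiling r => T.ribbon) := by
    intro T T' h
    have h' : T.ribbon = T'.ribbon := h
    refine MonotonicRibbonTiling.ext ?_ h'
    rw [← SetLike.coe_set_eq]
    have : T.shape.cells = T'.shape.cells := by rw [← T.union_eq, ← T'.union_eq, h']
    ext c
    change c ∈ T.shape ↔ c ∈ T'.shape
    rw [← YoungDiagram.mem_cells, ← YoungDiagram.mem_cells, this]
  refine Set.Finite.of_finite_image (f := fun T : MonotonicRibbonTiling r => T.ribbon) ?_
    hinj.injOn
  refine Set.Finite.subset (Set.Finite.pi' (t := fun _ : Fin r =>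
    ((range (∑ i, μ i) ×ˢ range (∑ i, μ i)).powerset : Set (Finset (ℕ × ℕ))))
    fun _ => Finset.finite_toSet _) ?_
  rintro _ ⟨T, ⟨w, hw⟩, rfl⟩ i
  have hcard : #T.shape.cells = ∑ i, μ i := by
    rw [← T.union_eq, Finset.card_biUnion (fun i _ j _ hij => T.disjoint i j hij),
      Finset.sum_congr rfl (fun i _ => hw i)]
    exact Equiv.sum_comp w μ
  rw [Finset.mem_coe, Finset.mem_powerset]
  rintro ⟨a, b⟩ hab
  have hmem : (a, b) ∈ T.shape := by
    rw [← YoungDiagram.mem_cells, ← T.union_eq]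
    exact Finset.mem_biUnion.2 ⟨i, mem_univ i, hab⟩
  rw [Finset.mem_product, Finset.mem_range, Finset.mem_range, ← hcard]
  constructor
  · refine lt_of_lt_of_le (YoungDiagram.mem_iff_lt_colLen.1 hmem) ?_
    rw [YoungDiagram.colLen_eq_card]
    exact Finset.card_le_card (Finset.filter_subset _ _)
  · refine lt_of_lt_of_le (YoungDiagram.mem_iff_lt_rowLen.1 hmem) ?_
    rw [YoungDiagram.rowLen_eq_card]
    exact Finset.card_le_card (Finset.filter_subset _ _)

/-- The finite set of all monotonic ribbon tilings whose ribbon sizes are a rearrangement of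
`μ`. -/
def tilings {r : ℕ} (μ : Fin r → ℕ) : Finset (MonotonicRibbonTiling r) :=
  (finite_hasSizes μ).toFinset

end

end PathMN

/-!
In finitely many variables `x_1, …, x_N`, both sides of the rule become the polynomial
`pathPoly N μ = ∑_g #{σ : g ∘ σ = g} ∏_t x_{g t}^{μ_t}`, the sum being over all words
`g : Fin r → Fin N`.

For the first identity, a permutation of the vertices that extends the paths is the same as a
permutation `σ` of the set of paths (`closePaths`), and a product of power sums over the cycles of
a permutation is the sum of the monomials of the words that are constant on these cycles
(`prod_permCycles_psum`). A word is constant on the cycles of `closePaths σ` if and only if it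
comes from a word that is constant on the cycles of `σ`, so that both sides sum the monomials of
all pairs `(σ, g)` with `g ∘ σ = g`.

For the second identity, multiply by the Vandermonde determinant `a_δ`. As `pathPoly` is symmetric,
the product is the weighted sum of the alternants `a_{δ + content g}` over all words `g`
(`alternant_mul_pathPoly`). More generally, consider the sum `wordAlternant μ J β` of the
alternants `a_{β + content g}` over the words `g` in the letters `≤ J`. It is alternating in the
first `J + 1` entries of `β` (`wordAlternant_comp`), and it satisfies a recursion
(`wordAlternant_succ`): the stabilizer of `g` is counted by taking away one of the occurrences of
the largest letter `j ≤ J` of `g`, which adds a block `μ_a` to the entry `β_j` and leaves a word in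
the letters `≤ j`. If `β = lam + δ` for a partition `lam`, then after this addition either two of
the first `j + 1` entries agree and the sum vanishes, or sorting these entries gives `lam' + δ`,
where `lam' / lam` is a ribbon of size `μ_a` with its tail in row `j`, and the sign of the sorting
permutation is the sign of the ribbon (`wordAlternant_add_single`). Iterating this adds ribbons
whose tails lie in rows `j_1 ≥ j_2 ≥ ⋯`, for all orderings of the parts of `μ`. Tail rows decrease
weakly if and only if tail columns increase strictly
(`MonotonicRibbonTiling.forall_tail_lt_iff`), so the result is a sum over monotonic ribbon tilings
(`ribbonSum_ofFn_append`). Each tiling occurs once for each ordering of the parts of `μ` with the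
same sequence of sizes, that is, `m(μ)!` times (`sum_tilingsOfSizes`).
-/

namespace PathMN

noncomputable section

/-! ### Truncation to finitely many variables -/

/-- The power series `F` and the polynomial `f` in the first `N` variables have the same
coefficients at all monomials in the first `N` variables; in other words, `f` is obtained from `F`
by setting the other variables to zero. -/
def AgreesWith (N : ℕ) (F : MvPowerSeries ℕ ℂ) (f : MvPolynomial (Fin N) ℂ) : Prop :=
  ∀ m : ℕ →₀ ℕ, (∀ i, N ≤ i → m i = 0) →
    MvPowerSeries.coeff m F =
      MvPolynomial.coeff m (MvPolynomial.rename (fun i : Fin N => (i : ℕ)) f)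

namespace AgreesWith

variable {N : ℕ} {F G : MvPowerSeries ℕ ℂ} {f g : MvPolynomial (Fin N) ℂ}

theorem one : AgreesWith N 1 1 := fun m _ => by
  classical
  rw [MvPowerSeries.coeff_one, map_one, MvPolynomial.coeff_one]
  simp [eq_comm]

theorem mul (hF : AgreesWith N F f) (hG : AgreesWith N G g) : AgreesWith N (F * G) (f * g) := by
  classical
  intro m hm
  rw [MvPowerSeries.coeff_mul, map_mul, MvPolynomial.coeff_mul]
  refine Finset.sum_congr rfl fun p hp => ?_
  rw [HasAntidiagonal.mem_antidiagonal] at hp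
  have h (i : ℕ) (hi : N ≤ i) : p.1 i + p.2 i = 0 := by
    rw [← Finsupp.add_apply, hp, hm i hi]
  rw [hF p.1 fun i hi => (Nat.add_eq_zero_iff.1 (h i hi)).1,
    hG p.2 fun i hi => (Nat.add_eq_zero_iff.1 (h i hi)).2]

theorem smul (c : ℂ) (hF : AgreesWith N F f) : AgreesWith N (c • F) (c • f) :=
  fun m hm => by simp [hF m hm]

theorem nsmul (c : ℕ) (hF : AgreesWith N F f) : AgreesWith N (c • F) (c • f) :=
  fun m hm => by
    rw [map_nsmul, map_nsmul, MvPolynomial.coeff_smul, hF m hm]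

theorem zsmul (c : ℤ) (hF : AgreesWith N F f) : AgreesWith N (c • F) (c • f) :=
  fun m hm => by
    rw [map_zsmul, map_zsmul, MvPolynomial.coeff_smul, hF m hm]

theorem sum {ι : Type*} {s : Finset ι} {F : ι → MvPowerSeries ℕ ℂ}
    {f : ι → MvPolynomial (Fin N) ℂ} (h : ∀ i ∈ s, AgreesWith N (F i) (f i)) :
    AgreesWith N (∑ i ∈ s, F i) (∑ i ∈ s, f i) := fun m hm => by
  rw [map_sum, map_sum, MvPolynomial.coeff_sum]
  exact Finset.sum_congr rfl fun i hi => h i hi m hm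

theorem prod {ι : Type*} {s : Finset ι} {F : ι → MvPowerSeries ℕ ℂ}
    {f : ι → MvPolynomial (Fin N) ℂ} (h : ∀ i ∈ s, AgreesWith N (F i) (f i)) :
    AgreesWith N (∏ i ∈ s, F i) (∏ i ∈ s, f i) := by
  classical
  induction s using Finset.induction_on with
  | empty => simpa using one
  | insert a s ha ih =>
    rw [prod_insert ha, prod_insert ha]
    exact (h a (mem_insert_self a s)).mul (ih fun i hi => h i (mem_insert_of_mem hi))

theorem powerSum {k : ℕ} (hk : k ≠ 0) :
    AgreesWith N (powerSum k) (MvPolynomial.psum (Fin N) ℂ k) := by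
  classical
  intro m hm
  have h0 : MvPowerSeries.coeff m (PathMN.powerSum k) =
    if ∃ i : ℕ, m = Finsupp.single i k then 1 else 0 := by
      simp only [MvPowerSeries.coeff]
      rfl
  rw [h0, MvPolynomial.psum, map_sum, MvPolynomial.coeff_sum]
  simp only [map_pow, MvPolynomial.rename_X, MvPolynomial.coeff_X_pow]
  split_ifs with h
  · obtain ⟨i, rfl⟩ := h
    have hi : i < N := by
      by_contra hi
      exact hk (by simpa using hm i (not_lt.1 hi))
    rw [Finset.sum_eq_single ⟨i, hi⟩]
    · simp
    · intro b _ hb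
      rw [if_neg]
      rw [Finsupp.single_left_inj hk]
      exact fun h => hb (Fin.ext h)
    · simp
  · refine (Finset.sum_eq_zero fun i _ => if_neg ?_).symm
    exact fun hi => h ⟨i, hi.symm⟩

theorem schurFunction {lam : YoungDiagram} (hN : lam.colLen 0 ≤ N) :
    AgreesWith N (schurFunction lam) (schurPoly N lam) :=
  fun m hm => coeff_schurFunction lam m N hN hm

end AgreesWith

/-- A power series is determined by its truncations to the first `N` variables, for all large
`N`. -/
theorem eq_of_agreesWith (N₀ : ℕ) {F G : MvPowerSeries ℕ ℂ}
    (h : ∀ N, N₀ ≤ N → ∃ f : MvPolynomial (Fin N) ℂ, AgreesWith N F f ∧ AgreesWith N G f) :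
    F = G := by
  ext m
  obtain ⟨f, hF, hG⟩ := h (max N₀ (m.support.sup Nat.succ)) (le_max_left _ _)
  have hm (i : ℕ) (hi : max N₀ (m.support.sup Nat.succ) ≤ i) : m i = 0 := by
    by_contra h
    have h1 := Finset.le_sup (f := Nat.succ) (Finsupp.mem_support_iff.2 h)
    have h2 := (le_max_right N₀ _).trans hi
    omega
  rw [hF m hm, hG m hm]

/-! ### Power sums indexed by the cycles of a permutation -/

theorem eq_filter_sameCycle {r : ℕ} {σ : Equiv.Perm (Fin r)} {C : Finset (Fin r)}
    (hC : C ∈ permCycles σ) {i : Fin r} (hi : i ∈ C) :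
    C = univ.filter fun j => σ.SameCycle i j := by
  obtain ⟨k, -, rfl⟩ := mem_image.1 hC
  rw [mem_filter] at hi
  ext j
  simp only [mem_filter, mem_univ, true_and]
  exact ⟨fun h => hi.2.symm.trans h, fun h => hi.2.trans h⟩

/-- The cycle of `σ` that contains a given element. -/
def cycleThrough {r : ℕ} (σ : Equiv.Perm (Fin r)) (i : Fin r) : permCycles σ :=
  ⟨univ.filter fun j => σ.SameCycle i j, mem_image_of_mem _ (mem_univ i)⟩

theorem mem_cycle_iff {r : ℕ} (σ : Equiv.Perm (Fin r)) (C : permCycles σ) (i : Fin r) :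
    i ∈ C.1 ↔ cycleThrough σ i = C := by
  constructor
  · exact fun h => Subtype.ext (eq_filter_sameCycle C.2 h).symm
  · rintro rfl
    simp [cycleThrough, Equiv.Perm.SameCycle.refl]

theorem cycleThrough_surjective {r : ℕ} (σ : Equiv.Perm (Fin r)) :
    Function.Surjective (cycleThrough σ) := by
  rintro ⟨C, hC⟩
  obtain ⟨k, -, rfl⟩ := mem_image.1 hC
  exact ⟨k, rfl⟩

theorem cycleThrough_eq_iff {r : ℕ} (σ : Equiv.Perm (Fin r)) (i j : Fin r) :
    cycleThrough σ i = cycleThrough σ j ↔ σ.SameCycle i j := by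
  rw [← mem_cycle_iff]
  simp only [cycleThrough, mem_filter, mem_univ, true_and]
  exact Equiv.Perm.sameCycle_comm

theorem apply_eq_of_sameCycle {α β : Type*} {σ : Equiv.Perm α} {g : α → β} (hg : g ∘ σ = g)
    {i j : α} (h : σ.SameCycle i j) : g i = g j := by
  obtain ⟨k, rfl⟩ := h
  have h1 (x : α) : g (σ x) = g x := congrFun hg x
  induction k with
  | zero => simp
  | succ n ih => rw [ih, add_comm, zpow_add, zpow_one, Equiv.Perm.mul_apply, h1]
  | pred n ih =>
    rw [ih, ← h1 ((σ ^ (-(n : ℤ) - 1)) i), ← Equiv.Perm.mul_apply, ← zpow_one_add]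
    congr 3
    ring

/-- The weighted content monomial `∏ t, X_{g t} ^ {μ t}` of a word `g`. -/
def wordMonomial {ι : Type*} [Fintype ι] {N : ℕ} (μ : ι → ℕ) (g : ι → Fin N) :
    MvPolynomial (Fin N) ℂ :=
  ∏ t, MvPolynomial.X (g t) ^ μ t

/-- A product of power sums over the cycles of `σ` is a sum over the words that are constant on
the cycles of `σ`. -/
theorem prod_permCycles_psum {r : ℕ} (N : ℕ) (σ : Equiv.Perm (Fin r)) (μ : Fin r → ℕ) :
    ∏ C ∈ permCycles σ, MvPolynomial.psum (Fin N) ℂ (∑ i ∈ C, μ i) =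
      ∑ g : Fin r → Fin N with g ∘ σ = g, wordMonomial μ g := by
  rw [← Finset.prod_coe_sort]
  unfold MvPolynomial.psum
  rw [Finset.prod_univ_sum, Fintype.piFinset_univ]
  refine Finset.sum_bij (fun x _ => x ∘ cycleThrough σ) ?_ ?_ ?_ ?_
  · intro x _
    rw [mem_filter]
    refine ⟨mem_univ _, funext fun i => ?_⟩
    simp only [Function.comp_apply]
    rw [(cycleThrough_eq_iff σ (σ i) i).2 (Equiv.Perm.sameCycle_apply_left.2 (.refl _ _))]
  · intro x _ y _ h
    exact (cycleThrough_surjective σ).injective_comp_right h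
  · intro g hg
    rw [mem_filter] at hg
    refine ⟨g ∘ Function.surjInv (cycleThrough_surjective σ), mem_univ _, funext fun i => ?_⟩
    refine apply_eq_of_sameCycle hg.2 ?_
    rw [← cycleThrough_eq_iff]
    exact Function.surjInv_eq _ _
  · intro x _
    unfold wordMonomial
    rw [← Finset.prod_fiberwise univ (cycleThrough σ)]
    refine Finset.prod_congr rfl fun C _ => ?_
    rw [← Finset.prod_pow_eq_pow_sum]
    have hC : (C.1 : Finset (Fin r)) = univ.filter fun i => cycleThrough σ i = C := by
      ext i
      simp [mem_cycle_iff]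
    rw [hC]
    refine Finset.prod_congr rfl fun i hi => ?_
    rw [Function.comp_apply, (mem_filter.1 hi).2]

/-- The parts of the cycle type of `w`, fixed points included, are the sizes of its cycles. -/
theorem prod_map_partition_parts {M : Type*} [CommMonoid M] {n : ℕ} (w : Equiv.Perm (Fin n))
    (p : ℕ → M) :
    (w.partition.parts.map p).prod = ∏ C ∈ permCycles w, p #C := by
  classical
  have hfix : ∀ i, i ∉ w.support → ∀ j, w.SameCycle i j ↔ j = i := by
    intro i hi j
    rw [Equiv.Perm.notMem_support] at hi
    constructor
    · rintro h
      exact (h.eq_of_left hi).symm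
    · rintro rfl
      exact .refl _ _
  have hsupp : ∀ i ∈ w.support, (univ.filter fun j => w.SameCycle i j) =
      (w.cycleOf i).support := by
    intro i hi
    ext j
    rw [Equiv.Perm.mem_support_cycleOf_iff]
    simp [hi]
  have hunion : permCycles w =
      w.cycleFactorsFinset.image Equiv.Perm.support ∪ (univ \ w.support).image singleton := by
    ext C
    simp only [permCycles, mem_image, mem_union, mem_univ, true_and, mem_sdiff]
    constructor
    · rintro ⟨i, rfl⟩
      by_cases hi : i ∈ w.support
      · exact Or.inl ⟨w.cycleOf i, Equiv.Perm.cycleOf_mem_cycleFactorsFinset_iff.2 hi,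
          (hsupp i hi).symm⟩
      · refine Or.inr ⟨i, hi, ?_⟩
        ext j
        simp [hfix i hi]
    · rintro (⟨c, hc, rfl⟩ | ⟨i, hi, rfl⟩)
      · obtain ⟨i, hi⟩ := (Equiv.Perm.mem_cycleFactorsFinset_iff.1 hc).1.nonempty_support
        have hci := (Equiv.Perm.cycle_is_cycleOf hi hc)
        refine ⟨i, ?_⟩
        rw [hsupp i (Equiv.Perm.mem_cycleFactorsFinset_support_le hc hi), ← hci]
      · refine ⟨i, ?_⟩
        ext j
        simp [hfix i hi]
  rw [Equiv.Perm.parts_partition, Multiset.map_add, Multiset.prod_add, hunion, prod_union,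
    prod_image, prod_image, Equiv.Perm.cycleType_def]
  · congr 1
    · rw [Multiset.map_map]
      rfl
    · simp [Finset.card_sdiff]
  · simp
  · intro c hc d hd hcd
    obtain ⟨i, hi⟩ := (Equiv.Perm.mem_cycleFactorsFinset_iff.1 hc).1.nonempty_support
    rw [Equiv.Perm.cycle_is_cycleOf hi hc,
      Equiv.Perm.cycle_is_cycleOf (by rwa [← hcd]) hd]
  · rw [Finset.disjoint_left]
    intro C hC hC'
    obtain ⟨c, hc, rfl⟩ := mem_image.1 hC
    obtain ⟨i, -, hi⟩ := mem_image.1 hC'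
    have := (Equiv.Perm.mem_cycleFactorsFinset_iff.1 hc).1.two_le_card_support
    rw [← hi] at this
    simp at this

/-! ### Permutations extending a disjoint union of paths -/

section ClosePaths

variable {r : ℕ} {μ : Fin r → ℕ} (hpos : ∀ i, 0 < μ i)

/-- The map that moves one step along the paths, and goes from the end of the path `i` to the
start of the path `σ i`. -/
def closePathsFun (σ : Equiv.Perm (Fin r)) (a : Σ i : Fin r, Fin (μ i)) :
    Σ i : Fin r, Fin (μ i) :=
  if h : (a.2 : ℕ) + 1 < μ a.1 then ⟨a.1, ⟨a.2 + 1, h⟩⟩ else ⟨σ a.1, ⟨0, hpos _⟩⟩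

theorem sigma_fin_ext {a b : Σ i : Fin r, Fin (μ i)} (h1 : a.1 = b.1)
    (h2 : (a.2 : ℕ) = b.2) : a = b := by
  obtain ⟨i, j⟩ := a
  obtain ⟨i', j'⟩ := b
  dsimp only at h1 h2
  subst h1
  rw [Fin.ext h2]

theorem closePathsFun_injective (σ : Equiv.Perm (Fin r)) :
    Function.Injective (closePathsFun hpos σ) := by
  intro a b h
  have ha := a.2.isLt
  have hb := b.2.isLt
  by_cases h3 : (a.2 : ℕ) + 1 < μ a.1 <;> by_cases h4 : (b.2 : ℕ) + 1 < μ b.1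
  · rw [closePathsFun, closePathsFun, dif_pos h3, dif_pos h4] at h
    have h2 := congrArg (fun c : Σ i : Fin r, Fin (μ i) => (c.2 : ℕ)) h
    exact sigma_fin_ext (congrArg Sigma.fst h :) (by simpa using h2)
  · rw [closePathsFun, closePathsFun, dif_pos h3, dif_neg h4] at h
    simpa using congrArg (fun c : Σ i : Fin r, Fin (μ i) => (c.2 : ℕ)) h
  · rw [closePathsFun, closePathsFun, dif_neg h3, dif_pos h4] at h
    simpa using congrArg (fun c : Σ i : Fin r, Fin (μ i) => (c.2 : ℕ)) h
  · rw [closePathsFun, closePathsFun, dif_neg h3, dif_neg h4] at h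
    have h5 : a.1 = b.1 := σ.injective (congrArg Sigma.fst h :)
    have h6 := congrArg μ h5
    exact sigma_fin_ext h5 (by omega)

/-- The permutation of the vertices of the paths that extends the paths and joins the end of the
path `i` to the start of the path `σ i`. -/
def closePaths (σ : Equiv.Perm (Fin r)) : Equiv.Perm (Σ i : Fin r, Fin (μ i)) :=
  Equiv.ofBijective _ (Finite.injective_iff_bijective.1 (closePathsFun_injective hpos σ))

theorem closePaths_apply_of_lt (σ : Equiv.Perm (Fin r)) (a : Σ i : Fin r, Fin (μ i))
    (h : (a.2 : ℕ) + 1 < μ a.1) : closePaths hpos σ a = ⟨a.1, ⟨a.2 + 1, h⟩⟩ :=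
  dif_pos h

theorem closePaths_apply_of_not_lt (σ : Equiv.Perm (Fin r)) (a : Σ i : Fin r, Fin (μ i))
    (h : ¬ (a.2 : ℕ) + 1 < μ a.1) : closePaths hpos σ a = ⟨σ a.1, ⟨0, hpos _⟩⟩ :=
  dif_neg h

/-- `w` moves one step along each path, as long as the path has not ended. -/
def ExtendsPaths (w : Equiv.Perm (Σ i : Fin r, Fin (μ i))) : Prop :=
  ∀ a b : Σ i : Fin r, Fin (μ i), a.1 = b.1 ∧ (b.2 : ℕ) = a.2 + 1 → w a = b

theorem extendsPaths_closePaths (σ : Equiv.Perm (Fin r)) :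
    ExtendsPaths (closePaths hpos σ) := by
  rintro a b ⟨h1, h2⟩
  have hb := b.2.isLt
  rw [h2, ← h1] at hb
  rw [closePaths_apply_of_lt hpos σ a hb]
  exact sigma_fin_ext h1 h2.symm

theorem closePaths_injective : Function.Injective (closePaths hpos) := by
  intro σ τ h
  ext1 i
  have hi := hpos i
  have h1 := congrArg (fun w => w ⟨i, ⟨μ i - 1, by omega⟩⟩) h
  rw [closePaths_apply_of_not_lt _ _ _ (by dsimp only; omega),
    closePaths_apply_of_not_lt _ _ _ (by dsimp only; omega)] at h1
  exact congrArg Sigma.fst h1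

theorem exists_eq_closePaths {w : Equiv.Perm (Σ i : Fin r, Fin (μ i))} (hw : ExtendsPaths w) :
    ∃ σ, closePaths hpos σ = w := by
  have hzero (a : Σ i : Fin r, Fin (μ i)) (ha : ¬ (a.2 : ℕ) + 1 < μ a.1) :
      ((w a).2 : ℕ) = 0 := by
    by_contra h
    have hlt := (w a).2.isLt
    -- otherwise `w a` has a predecessor on its path, which is mapped to `w a`, too
    have h1 := hw ⟨(w a).1, ⟨(w a).2 - 1, by omega⟩⟩ (w a) ⟨rfl, by dsimp only; omega⟩
    have h2 := w.injective h1
    apply ha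
    rw [← h2]
    dsimp only
    omega
  let l (i : Fin r) : Σ i : Fin r, Fin (μ i) := ⟨i, ⟨μ i - 1, Nat.sub_lt (hpos i) one_pos⟩⟩
  have hl (i : Fin r) : ¬ ((l i).2 : ℕ) + 1 < μ (l i).1 := by
    have := hpos i
    dsimp only [l]
    omega
  have hinj : Function.Injective fun i => (w (l i)).1 := by
    intro i j h
    have h1 : w (l i) = w (l j) := sigma_fin_ext h (by rw [hzero _ (hl i), hzero _ (hl j)])
    exact congrArg Sigma.fst (w.injective h1)
  refine ⟨Equiv.ofBijective _ (Finite.injective_iff_bijective.1 hinj), Equiv.ext fun a => ?_⟩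
  by_cases ha : (a.2 : ℕ) + 1 < μ a.1
  · rw [closePaths_apply_of_lt _ _ _ ha]
    exact (hw a ⟨a.1, ⟨a.2 + 1, ha⟩⟩ ⟨rfl, rfl⟩).symm
  · rw [closePaths_apply_of_not_lt _ _ _ ha]
    have hal : a = l a.1 := sigma_fin_ext rfl (by
      have := a.2.isLt
      dsimp only [l]
      omega)
    refine sigma_fin_ext ?_ ?_
    · rw [hal]
      rfl
    · rw [hzero _ ha]

/-- A word is constant on the cycles of `closePaths σ` if and only if it is constant on the paths
and on the cycles of `σ`. -/
theorem comp_closePaths_eq_iff {β : Type*} (σ : Equiv.Perm (Fin r))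
    (f : (Σ i : Fin r, Fin (μ i)) → β) :
    f ∘ closePaths hpos σ = f ↔ ∃ g : Fin r → β, g ∘ σ = g ∧ g ∘ Sigma.fst = f := by
  constructor
  · intro h
    have hc (i : Fin r) (k : ℕ) (hk : k < μ i) : f ⟨i, ⟨k, hk⟩⟩ = f ⟨i, ⟨0, hpos i⟩⟩ := by
      induction k with
      | zero => rfl
      | succ k ih =>
        rw [← ih (by omega), ← congrFun h ⟨i, ⟨k, by omega⟩⟩, Function.comp_apply,
          closePaths_apply_of_lt _ _ _ hk]
    refine ⟨fun i => f ⟨i, ⟨0, hpos i⟩⟩, funext fun i => ?_, funext fun a => (hc _ _ _).symm⟩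
    have hi := hpos i
    rw [← hc i (μ i - 1) (by omega), ← congrFun h ⟨i, ⟨μ i - 1, by omega⟩⟩,
      Function.comp_apply, Function.comp_apply,
      closePaths_apply_of_not_lt _ _ _ (by dsimp only; omega)]
  · rintro ⟨g, hg, rfl⟩
    funext a
    by_cases ha : (a.2 : ℕ) + 1 < μ a.1
    · simp [closePaths_apply_of_lt _ _ _ ha]
    · simp only [Function.comp_apply, closePaths_apply_of_not_lt _ _ _ ha]
      exact congrFun hg _

end ClosePaths

/-- The permutations that are counted by the indicator function of a union of paths are the ones
extending these paths. -/
theorem forall_apply_I_eq_J_iff {n k r : ℕ} {μ : Fin r → ℕ} (P : PartialPerm n k)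
    (e : (Σ i : Fin r, Fin (μ i)) ≃ Fin n)
    (he : ∀ a b : Σ i : Fin r, Fin (μ i),
      (∃ t, P.I t = e a ∧ P.J t = e b) ↔ a.1 = b.1 ∧ (b.2 : ℕ) = a.2 + 1)
    (w : Equiv.Perm (Σ i : Fin r, Fin (μ i))) :
    (∀ t, e.permCongr w (P.I t) = P.J t) ↔ ExtendsPaths w := by
  constructor
  · rintro h a b hab
    obtain ⟨t, h1, h2⟩ := (he a b).2 hab
    have := h t
    rw [h1, h2] at this
    simpa using this
  · intro h t
    have := h (e.symm (P.I t)) (e.symm (P.J t)) ((he _ _).1 ⟨t, by simp, by simp⟩)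
    rw [Equiv.permCongr_apply, this, Equiv.apply_symm_apply]

/-- The symmetric polynomial `∑_g #{σ : g ∘ σ = g} ∏_t X_{g t} ^ {μ t}` in `N` variables, to which
both sides of the path Murnaghan–Nakayama rule truncate. -/
def pathPoly {r : ℕ} (N : ℕ) (μ : Fin r → ℕ) : MvPolynomial (Fin N) ℂ :=
  ∑ g : Fin r → Fin N, #{σ : Equiv.Perm (Fin r) | g ∘ σ = g} • wordMonomial μ g

theorem pathPoly_eq {r : ℕ} (N : ℕ) (μ : Fin r → ℕ) :
    pathPoly N μ = ∑ σ : Equiv.Perm (Fin r), ∑ g : Fin r → Fin N with g ∘ σ = g,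
      wordMonomial μ g := by
  simp only [pathPoly, Finset.sum_filter]
  rw [Finset.sum_comm]
  refine Finset.sum_congr rfl fun g _ => ?_
  rw [← Finset.sum_filter, Finset.sum_const]

theorem agreesWith_sum_permCycles {r : ℕ} (N : ℕ) (μ : Fin r → ℕ) (hpos : ∀ i, 0 < μ i) :
    AgreesWith N (∑ σ : Equiv.Perm (Fin r), ∏ C ∈ permCycles σ, powerSum (∑ i ∈ C, μ i))
      (pathPoly N μ) := by
  rw [pathPoly_eq]
  refine AgreesWith.sum fun σ _ => ?_
  rw [← prod_permCycles_psum]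
  refine AgreesWith.prod fun C hC => AgreesWith.powerSum ?_
  obtain ⟨i, -, rfl⟩ := mem_image.1 hC
  refine (Finset.sum_pos (fun i _ => hpos i) ⟨i, ?_⟩).ne'
  simp [Equiv.Perm.SameCycle.refl]

/-- Averaging over conjugation does not change the characteristic. -/
theorem frobeniusCh_reynolds {n : ℕ} (f : Equiv.Perm (Fin n) → ℂ) :
    frobeniusCh (reynolds f) = frobeniusCh f := by
  unfold frobeniusCh reynolds
  congr 1
  have hn : (n.factorial : ℂ) ≠ 0 := by exact_mod_cast n.factorial_ne_zero
  have hconj (v w : Equiv.Perm (Fin n)) : (v * w * v⁻¹).partition = w.partition :=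
    (Equiv.Perm.partition_eq_of_isConj.1 (isConj_iff.2 ⟨v, rfl⟩)).symm
  calc ∑ w : Equiv.Perm (Fin n), ((1 / (n.factorial : ℂ)) * ∑ v, f (v * w * v⁻¹)) •
        (w.partition.parts.map powerSum).prod
      = (1 / (n.factorial : ℂ)) • ∑ v : Equiv.Perm (Fin n), ∑ w : Equiv.Perm (Fin n),
          f (v * w * v⁻¹) • ((v * w * v⁻¹).partition.parts.map powerSum).prod := by
        simp only [hconj, mul_smul, Finset.sum_smul, ← Finset.smul_sum]
        rw [Finset.sum_comm]
    _ = (1 / (n.factorial : ℂ)) • ∑ v : Equiv.Perm (Fin n), ∑ w : Equiv.Perm (Fin n),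
          f w • (w.partition.parts.map powerSum).prod := by
        congr 1
        refine Finset.sum_congr rfl fun v _ => ?_
        exact Equiv.sum_comp (MulAut.conj v).toEquiv
          (fun w => f w • (w.partition.parts.map powerSum).prod)
    _ = _ := by
        have hcard : #(univ : Finset (Equiv.Perm (Fin n))) = n.factorial := by
          rw [Finset.card_univ, Fintype.card_perm, Fintype.card_fin]
        rw [Finset.sum_const, hcard, ← Nat.cast_smul_eq_nsmul ℂ, smul_smul, one_div, inv_mul_cancel₀ hn, one_smul]

theorem atomic_eq_sum {n k : ℕ} (P : PartialPerm n k) :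
    P.atomic = ∑ w : Equiv.Perm (Fin n), P.indicator w • ∏ C ∈ permCycles w, powerSum #C := by
  have hn : (n.factorial : ℂ) ≠ 0 := by exact_mod_cast n.factorial_ne_zero
  rw [PartialPerm.atomic, frobeniusCh_reynolds, frobeniusCh, smul_smul, mul_one_div_cancel hn,
    one_smul]
  simp only [prod_map_partition_parts]

theorem agreesWith_atomic {n k r : ℕ} (N : ℕ) (μ : Fin r → ℕ) (hpos : ∀ i, 0 < μ i)
    (P : PartialPerm n k) (hP : P.IsDisjointPaths μ) :
    AgreesWith N P.atomic (pathPoly N μ) := by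
  classical
  obtain ⟨e, he⟩ := hP
  have hw (w : Equiv.Perm (Fin n)) : AgreesWith N (∏ C ∈ permCycles w, powerSum #C)
      (∑ f : Fin n → Fin N with f ∘ w = f, wordMonomial (fun _ => 1) f) := by
    rw [← prod_permCycles_psum]
    refine AgreesWith.prod fun C hC => ?_
    obtain ⟨i, -, rfl⟩ := mem_image.1 hC
    rw [← Finset.card_eq_sum_ones]
    refine AgreesWith.powerSum (Finset.card_pos.2 ⟨i, ?_⟩).ne'
    simp [Equiv.Perm.SameCycle.refl]
  rw [atomic_eq_sum]
  have key : pathPoly N μ = ∑ w : Equiv.Perm (Fin n), P.indicator w •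
      ∑ f : Fin n → Fin N with f ∘ w = f, wordMonomial (fun _ => 1) f := by
    simp only [PartialPerm.indicator, ite_smul, one_smul, zero_smul]
    rw [← Finset.sum_filter, pathPoly_eq]
    refine Finset.sum_bij (fun σ _ => e.permCongr (closePaths hpos σ)) ?_ ?_ ?_ ?_
    · intro σ _
      rw [mem_filter]
      exact ⟨mem_univ _, (forall_apply_I_eq_J_iff P e he _).2 (extendsPaths_closePaths hpos σ)⟩
    · intro σ _ τ _ h
      exact closePaths_injective hpos (e.permCongr.injective h)
    · intro w hw
      rw [mem_filter] at hw
      obtain ⟨w, rfl⟩ := e.permCongr.surjective w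
      obtain ⟨σ, rfl⟩ := exists_eq_closePaths hpos ((forall_apply_I_eq_J_iff P e he w).1 hw.2)
      exact ⟨σ, mem_univ _, rfl⟩
    · intro σ _
      have hcomp (f : Fin n → Fin N) : f ∘ e.permCongr (closePaths hpos σ) = f ↔
          (f ∘ e) ∘ closePaths hpos σ = f ∘ e := by
        constructor
        · intro h
          funext a
          have := congrFun h (e a)
          simpa using this
        · intro h
          funext a
          have := congrFun h (e.symm a)
          simpa using this
      refine Finset.sum_bij (fun g _ => (g ∘ Sigma.fst) ∘ e.symm) ?_ ?_ ?_ ?_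
      · intro g hg
        rw [mem_filter] at hg ⊢
        refine ⟨mem_univ _, (hcomp _).2 ?_⟩
        rw [comp_closePaths_eq_iff]
        refine ⟨g, hg.2, ?_⟩
        funext a
        simp
      · intro g _ g' _ h
        funext i
        have := congrFun h (e ⟨i, ⟨0, hpos i⟩⟩)
        simpa using this
      · intro f hf
        rw [mem_filter, hcomp, comp_closePaths_eq_iff] at hf
        obtain ⟨g, hg, hgf⟩ := hf.2
        refine ⟨g, by simpa using hg, ?_⟩
        rw [hgf]
        funext a
        simp
      · intro g _
        unfold wordMonomial
        rw [← e.prod_comp, Fintype.prod_sigma]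
        simp
  rw [key]
  exact AgreesWith.sum fun w _ => (hw w).smul _

/-! ### Symmetrized sums of alternants -/

/-- The content of a word `g` in which the letter `g t` is counted `μ t` times. -/
def content {r N : ℕ} (μ : Fin r → ℕ) (g : Fin r → Fin N) : Fin N → ℕ :=
  ∑ t, Pi.single (g t) (μ t)

/-- The sum of the alternants `ε · x^(β + content g)` over the words `g` in the letters `≤ J`,
each counted with the order of its stabilizer. -/
def wordAlternant {r N : ℕ} (μ : Fin r → ℕ) (J : ℕ) (β : Fin N → ℕ) : MvPolynomial (Fin N) ℂ :=
  ∑ g : Fin r → Fin N with ∀ t, (g t : ℕ) ≤ J,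
    #{σ : Equiv.Perm (Fin r) | g ∘ σ = g} • alternant N (β + content μ g)

theorem content_comp_apply {r N : ℕ} (μ : Fin r → ℕ) (g : Fin r → Fin N)
    (τ : Equiv.Perm (Fin N)) (i : Fin N) : content μ (τ ∘ g) (τ i) = content μ g i := by
  simp only [content, Finset.sum_apply, Function.comp_apply, Pi.single_apply,
    EmbeddingLike.apply_eq_iff_eq]

theorem card_stabilizer_comp {r N : ℕ} (g : Fin r → Fin N) (τ : Equiv.Perm (Fin N)) :
    #{σ : Equiv.Perm (Fin r) | (τ ∘ g) ∘ σ = τ ∘ g} =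
      #{σ : Equiv.Perm (Fin r) | g ∘ σ = g} := by
  simp only [Function.comp_assoc, τ.injective.comp_left.eq_iff]

theorem alternant_eq_sum {N : ℕ} (a : Fin N → ℕ) :
    alternant N a = ∑ τ : Equiv.Perm (Fin N), Equiv.Perm.sign τ •
      ∏ i, (MvPolynomial.X (τ i) : MvPolynomial (Fin N) ℂ) ^ a i := by
  rw [alternant, Matrix.det_apply]
  simp

theorem alternant_comp {N : ℕ} (a : Fin N → ℕ) (τ : Equiv.Perm (Fin N)) :
    alternant N (a ∘ τ) = Equiv.Perm.sign τ • alternant N a := by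
  have h := Matrix.det_permute' τ
    (Matrix.of fun i j : Fin N => (MvPolynomial.X i : MvPolynomial (Fin N) ℂ) ^ a j)
  rw [alternant, alternant, Units.smul_def, zsmul_eq_mul, ← h]
  rfl

theorem prod_X_pow_content {r N : ℕ} (μ : Fin r → ℕ) (g : Fin r → Fin N)
    (τ : Equiv.Perm (Fin N)) :
    ∏ i, (MvPolynomial.X (τ i) : MvPolynomial (Fin N) ℂ) ^ content μ g i =
      wordMonomial μ (τ ∘ g) := by
  simp only [content, Finset.sum_apply, ← Finset.prod_pow_eq_pow_sum, wordMonomial]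
  rw [Finset.prod_comm]
  refine Finset.prod_congr rfl fun t _ => ?_
  rw [Finset.prod_eq_single (g t)]
  · simp
  · intro i _ hi
    rw [Pi.single_eq_of_ne hi, pow_zero]
  · simp

/-- Since `pathPoly` is symmetric, its product with an alternant can be computed inside the
antisymmetrization. -/
theorem alternant_mul_pathPoly {r N : ℕ} (μ : Fin r → ℕ) (β : Fin N → ℕ) :
    alternant N β * pathPoly N μ = wordAlternant μ N β := by
  have hf : (univ.filter fun g : Fin r → Fin N => ∀ t, (g t : ℕ) ≤ N) = univ := by
    rw [Finset.filter_true_of_mem]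
    exact fun g _ t => (g t).isLt.le
  have h (τ : Equiv.Perm (Fin N)) : pathPoly N μ = ∑ g : Fin r → Fin N,
      #{σ : Equiv.Perm (Fin r) | g ∘ σ = g} • wordMonomial μ (τ ∘ g) := by
    rw [pathPoly, ← Equiv.sum_comp (Equiv.arrowCongr (Equiv.refl (Fin r)) τ)]
    refine Finset.sum_congr rfl fun g _ => ?_
    rw [← card_stabilizer_comp g τ]
    rfl
  rw [wordAlternant, hf]
  simp only [alternant_eq_sum, Pi.add_apply, pow_add, Finset.prod_mul_distrib,
    prod_X_pow_content, Finset.smul_sum, Finset.sum_mul]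
  rw [Finset.sum_comm]
  refine Finset.sum_congr rfl fun τ _ => ?_
  rw [h τ, Finset.mul_sum]
  refine Finset.sum_congr rfl fun g _ => ?_
  rw [smul_mul_assoc, mul_smul_comm, smul_comm]

/-- `wordAlternant` is alternating in the entries of `β` with index at most `J`. -/
theorem wordAlternant_comp {r N : ℕ} (μ : Fin r → ℕ) (J : ℕ) (β : Fin N → ℕ)
    (τ : Equiv.Perm (Fin N)) (hτ : ∀ i, (τ i : ℕ) ≤ J ↔ (i : ℕ) ≤ J) :
    wordAlternant μ J (β ∘ τ) = Equiv.Perm.sign τ • wordAlternant μ J β := by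
  unfold wordAlternant
  rw [Finset.smul_sum]
  refine Finset.sum_bij (fun g _ => τ ∘ g) ?_ ?_ ?_ ?_
  · intro g hg
    rw [mem_filter] at hg ⊢
    exact ⟨mem_univ _, fun t => (hτ _).2 (hg.2 t)⟩
  · intro g _ g' _ h
    exact τ.injective.comp_left h
  · intro g hg
    rw [mem_filter] at hg
    refine ⟨τ.symm ∘ g, ?_, ?_⟩
    · rw [mem_filter]
      refine ⟨mem_univ _, fun t => (hτ _).1 ?_⟩
      simpa using hg.2 t
    · funext t
      simp
  · intro g _
    have h : β ∘ τ + content μ g = (β + content μ (τ ∘ g)) ∘ τ := by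
      funext i
      simp [content_comp_apply]
    rw [h, alternant_comp, card_stabilizer_comp, smul_comm]

theorem wordAlternant_eq_zero {r N : ℕ} (μ : Fin r → ℕ) (J : ℕ) (β : Fin N → ℕ) {i j : Fin N}
    (hij : i ≠ j) (hi : (i : ℕ) ≤ J) (hj : (j : ℕ) ≤ J) (h : β i = β j) :
    wordAlternant μ J β = 0 := by
  have h1 := wordAlternant_comp μ J β (Equiv.swap i j) (fun k => by
    rcases eq_or_ne k i with rfl | hki
    · simp [hi, hj]
    rcases eq_or_ne k j with rfl | hkj
    · simp [hi, hj]
    rw [Equiv.swap_apply_of_ne_of_ne hki hkj])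
  have h2 : β ∘ Equiv.swap i j = β := by
    funext k
    rcases eq_or_ne k i with rfl | hki
    · simp [h]
    rcases eq_or_ne k j with rfl | hkj
    · simp [h]
    rw [Function.comp_apply, Equiv.swap_apply_of_ne_of_ne hki hkj]
  rw [h2, Equiv.Perm.sign_swap hij, Units.neg_smul, one_smul] at h1
  exact self_eq_neg.1 h1

theorem card_stabilizer_eq_prod {r N : ℕ} (g : Fin r → Fin N) :
    #{σ : Equiv.Perm (Fin r) | g ∘ σ = g} = ∏ j, (#{t | g t = j}).factorial := by
  rw [← Fintype.card_subtype, DomMulAct.stabilizer_card]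
  simp only [Fintype.card_subtype]

theorem card_fiber_swap {r N : ℕ} (g : Fin (r + 1) → Fin N) (a : Fin (r + 1)) (j : Fin N) :
    #{t | g t = j} = (if g a = j then 1 else 0) +
      #{t : Fin r | g (Equiv.swap 0 a t.succ) = j} := by
  simp only [Finset.card_filter]
  rw [← Equiv.sum_comp (Equiv.swap 0 a), Fin.sum_univ_succ, Equiv.swap_apply_left]

/-- The stabilizer of a word is counted by removing one of the occurrences of its largest
letter. -/
theorem card_stabilizer_succ {r N : ℕ} (g : Fin (r + 1) → Fin N) :
    #{σ : Equiv.Perm (Fin (r + 1)) | g ∘ σ = g} =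
      ∑ a with ∀ t, g t ≤ g a, #{σ : Equiv.Perm (Fin r) |
        (fun t : Fin r => g (Equiv.swap 0 a t.succ)) ∘ σ =
          fun t : Fin r => g (Equiv.swap 0 a t.succ)} := by
  obtain ⟨b, hb⟩ := Finite.exists_max g
  have hfilter : (univ.filter fun a => ∀ t, g t ≤ g a) = univ.filter fun a => g a = g b := by
    ext a
    simp only [mem_filter, mem_univ, true_and]
    exact ⟨fun h => le_antisymm (hb a) (h b), fun h t => h ▸ hb t⟩
  have hpos : 0 < #{t | g t = g b} := Finset.card_pos.2 ⟨b, by simp⟩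
  -- each of the occurrences of the largest letter contributes the same amount
  rw [hfilter]
  refine Nat.eq_of_mul_eq_mul_left hpos ?_
  rw [Finset.mul_sum, ← smul_eq_mul, ← Finset.sum_const]
  refine Finset.sum_congr rfl fun a ha => ?_
  rw [mem_filter] at ha
  rw [card_stabilizer_eq_prod, card_stabilizer_eq_prod,
    ← Finset.mul_prod_erase _ _ (mem_univ (g b)),
    ← Finset.mul_prod_erase _ _ (mem_univ (g b)), ← mul_assoc]
  congr 1
  · rw [card_fiber_swap g a (g b), if_pos ha.2, add_comm 1, Nat.factorial_succ]
  · refine Finset.prod_congr rfl fun j hj => ?_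
    rw [card_fiber_swap g a j, if_neg, zero_add]
    rw [ha.2]
    exact (Finset.ne_of_mem_erase hj).symm

/-- Summing first over one of the blocks that are added to the largest position. -/
theorem wordAlternant_succ {r N : ℕ} (μ : Fin (r + 1) → ℕ) (J : ℕ) (β : Fin N → ℕ) :
    wordAlternant μ J β = ∑ a, ∑ j ∈ univ.filter (fun j : Fin N => (j : ℕ) ≤ J),
      wordAlternant (fun t : Fin r => μ (Equiv.swap 0 a t.succ)) j (β + Pi.single j (μ a)) := by
  have h1 : wordAlternant μ J β = ∑ a, ∑ g : Fin (r + 1) → Fin N,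
      if (∀ t, (g t : ℕ) ≤ J) ∧ ∀ t, g t ≤ g a then
        #{σ : Equiv.Perm (Fin r) | (fun t : Fin r => g (Equiv.swap 0 a t.succ)) ∘ σ =
          fun t : Fin r => g (Equiv.swap 0 a t.succ)} • alternant N (β + content μ g)
      else 0 := by
    rw [wordAlternant, Finset.sum_comm, Finset.sum_filter]
    refine Finset.sum_congr rfl fun g _ => ?_
    split_ifs with hg
    · rw [card_stabilizer_succ, Finset.sum_smul, Finset.sum_filter]
      simp only [hg, implies_true, true_and]
    · simp [hg]
  rw [h1]
  refine Finset.sum_congr rfl fun a _ => ?_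
  rw [← Equiv.sum_comp (Equiv.arrowCongr (Equiv.swap 0 a) (Equiv.refl (Fin N))),
    ← Equiv.sum_comp (Fin.consEquiv fun _ => Fin N), Fintype.sum_prod_type, Finset.sum_filter]
  refine Finset.sum_congr rfl fun j _ => ?_
  have hap (h : Fin r → Fin N) (t : Fin (r + 1)) :
      (Equiv.arrowCongr (Equiv.swap 0 a) (Equiv.refl (Fin N)))
        (Fin.consEquiv (fun _ => Fin N) (j, h)) t =
      (Fin.cons j h : Fin (r + 1) → Fin N) (Equiv.swap 0 a t) := by
    simp [Equiv.arrowCongr]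
  have hcond (h : Fin r → Fin N) :
      ((∀ t, (((Fin.cons j h : Fin (r + 1) → Fin N) (Equiv.swap 0 a t) : Fin N) : ℕ) ≤ J) ∧
        ∀ t, (Fin.cons j h : Fin (r + 1) → Fin N) (Equiv.swap 0 a t) ≤ j) ↔
      (j : ℕ) ≤ J ∧ ∀ t, (h t : ℕ) ≤ j := by
    rw [(Equiv.swap 0 a).forall_congr_right
        (q := fun t => (((Fin.cons j h : Fin (r + 1) → Fin N) t : Fin N) : ℕ) ≤ J),
      (Equiv.swap 0 a).forall_congr_right
        (q := fun t => (Fin.cons j h : Fin (r + 1) → Fin N) t ≤ j)]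
    simp only [Fin.forall_fin_succ, Fin.cons_zero, Fin.cons_succ, le_refl, true_and]
    constructor
    · exact fun h => ⟨h.1.1, h.2⟩
    · exact fun h => ⟨⟨h.1, fun t => (h.2 t).trans h.1⟩, h.2⟩
  have hcontent (h : Fin r → Fin N) :
      content μ (fun t => (Fin.cons j h : Fin (r + 1) → Fin N) (Equiv.swap 0 a t)) =
        Pi.single j (μ a) + content (fun t : Fin r => μ (Equiv.swap 0 a t.succ)) h := by
    unfold content
    rw [← Equiv.sum_comp (Equiv.swap 0 a), Fin.sum_univ_succ]
    simp
  simp only [funext (hap _), Equiv.swap_apply_right, Equiv.swap_apply_self, Fin.cons_zero,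
    Fin.cons_succ, hcond, hcontent]
  split_ifs with hj
  · rw [wordAlternant, Finset.sum_filter]
    simp only [hj, true_and, add_assoc]
  · simp [hj]

/-! ### Adding a ribbon to a partition -/

/-- `lam'` arises from `lam` by adding a ribbon that occupies the rows `i, …, j`: each of these
rows but the first one is filled up to one cell more than the old row above it. -/
structure IsRibbonStep (lam lam' : YoungDiagram) (i j : ℕ) : Prop where
  le : i ≤ j
  top : lam.rowLen i < lam'.rowLen i
  mid : ∀ s, i ≤ s → s < j → lam'.rowLen (s + 1) = lam.rowLen s + 1
  above : ∀ s, s < i → lam'.rowLen s = lam.rowLen s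
  below : ∀ s, j < s → lam'.rowLen s = lam.rowLen s

/-- `lam'` arises from `lam` by adding a ribbon of size `k` with its tail in row `j`. -/
def IsRibbonStepOfSize (lam : YoungDiagram) (j k : ℕ) (lam' : YoungDiagram) : Prop :=
  ∃ i, IsRibbonStep lam lam' i j ∧ lam'.rowLen i + (j - i) = lam.rowLen j + k

theorem rowLen_ext {lam nu : YoungDiagram} (h : ∀ s, lam.rowLen s = nu.rowLen s) : lam = nu := by
  refine SetLike.ext fun c => ?_
  obtain ⟨s, t⟩ := c
  rw [YoungDiagram.mem_iff_lt_rowLen, YoungDiagram.mem_iff_lt_rowLen, h]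

theorem exists_rowLen_eq (f : ℕ → ℕ) (hf : Antitone f) (n : ℕ) (hn : f n = 0) :
    ∃ lam : YoungDiagram, ∀ s, lam.rowLen s = f s := by
  have hlow : IsLowerSet (((range n ×ˢ range (f 0)).filter fun c => c.2 < f c.1 :
      Finset (ℕ × ℕ)) : Set (ℕ × ℕ)) := by
    rintro ⟨a, b⟩ ⟨c, d⟩ ⟨h1, h2⟩ h
    simp only [coe_filter, mem_product, mem_range, Set.mem_ofPred_eq] at h ⊢ h1 h2
    have := hf h1
    exact ⟨⟨by omega, by omega⟩, by omega⟩
  refine ⟨⟨_, hlow⟩, fun s => eq_of_forall_lt_iff fun c => ?_⟩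
  rw [← YoungDiagram.mem_iff_lt_rowLen, YoungDiagram.mem_mk, mem_filter, mem_product,
    mem_range, mem_range]
  refine ⟨fun h => h.2, fun h => ⟨⟨?_, h.trans_le (hf (Nat.zero_le s))⟩, h⟩⟩
  by_contra hs
  have h1 : f s ≤ f n := hf (not_lt.1 hs)
  have h2 : c < f s := h
  omega

theorem rowLen_eq_zero {lam : YoungDiagram} {s : ℕ} (hs : lam.colLen 0 ≤ s) :
    lam.rowLen s = 0 := by
  by_contra h
  have h1 : (s, 0) ∈ lam := YoungDiagram.mem_iff_lt_rowLen.2 (Nat.pos_of_ne_zero h)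
  exact absurd (YoungDiagram.mem_iff_lt_colLen.1 h1) (not_lt.2 hs)

theorem rowLen_le_of_le {lam nu : YoungDiagram} (h : lam ≤ nu) (s : ℕ) :
    lam.rowLen s ≤ nu.rowLen s := by
  by_contra hlt
  have h1 : (s, nu.rowLen s) ∈ lam := YoungDiagram.mem_iff_lt_rowLen.2 (not_le.1 hlt)
  exact lt_irrefl _ (YoungDiagram.mem_iff_lt_rowLen.1 (h h1))

theorem le_of_rowLen_le {lam nu : YoungDiagram} (h : ∀ s, lam.rowLen s ≤ nu.rowLen s) :
    lam ≤ nu := by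
  rintro ⟨s, c⟩ hc
  rw [YoungDiagram.mem_iff_lt_rowLen] at hc ⊢
  exact hc.trans_le (h s)

theorem mem_cells_sdiff {lam nu : YoungDiagram} {s c : ℕ} :
    (s, c) ∈ nu.cells \ lam.cells ↔ lam.rowLen s ≤ c ∧ c < nu.rowLen s := by
  rw [mem_sdiff, YoungDiagram.mem_cells, YoungDiagram.mem_cells,
    YoungDiagram.mem_iff_lt_rowLen, YoungDiagram.mem_iff_lt_rowLen, not_lt, and_comm]

theorem card_cells_eq_sum_rowLen {lam : YoungDiagram} {M : ℕ} (hM : lam.colLen 0 ≤ M) :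
    #lam.cells = ∑ s : Fin M, lam.rowLen s := by
  rw [Finset.card_eq_sum_card_fiberwise (f := Prod.fst) (t := range M),
    ← Fin.sum_univ_eq_sum_range (fun s => #(lam.cells.filter fun c => c.1 = s))]
  · refine Finset.sum_congr rfl fun s _ => ?_
    rw [YoungDiagram.rowLen_eq_card]
    rfl
  · rintro ⟨s, c⟩ hc
    have h1 : (s, c) ∈ lam := hc
    rw [coe_range, Set.mem_Iio]
    by_contra hs
    have := rowLen_eq_zero (hM.trans (not_lt.1 hs))
    rw [YoungDiagram.mem_iff_lt_rowLen, this] at h1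
    omega

namespace IsRibbonStep

variable {lam lam' : YoungDiagram} {i j : ℕ}

theorem rowLen_lt (h : IsRibbonStep lam lam' i j) {s : ℕ} (h1 : i ≤ s) (h2 : s ≤ j) :
    lam.rowLen s < lam'.rowLen s := by
  rcases h1.eq_or_lt with rfl | h1
  · exact h.top
  · obtain ⟨s, rfl⟩ : ∃ t, s = t + 1 := ⟨s - 1, by omega⟩
    rw [h.mid s (by omega) (by omega)]
    have := lam.rowLen_anti s (s + 1) (by omega)
    omega

theorem le_lam (h : IsRibbonStep lam lam' i j) : lam ≤ lam' := by
  refine le_of_rowLen_le fun s => ?_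
  by_cases h1 : s < i
  · exact (h.above s h1).ge
  by_cases h2 : j < s
  · exact (h.below s h2).ge
  · exact (h.rowLen_lt (by omega) (by omega)).le

theorem le_of_mem (h : IsRibbonStep lam lam' i j) {s c : ℕ}
    (hc : (s, c) ∈ lam'.cells \ lam.cells) : i ≤ s ∧ s ≤ j := by
  rw [mem_cells_sdiff] at hc
  constructor
  · by_contra h1
    have := h.above s (by omega)
    omega
  · by_contra h1
    have := h.below s (by omega)
    omega

theorem isTail (h : IsRibbonStep lam lam' i j) :
    IsTail (lam'.cells \ lam.cells) (j, lam.rowLen j) := by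
  refine ⟨mem_cells_sdiff.2 ⟨le_rfl, h.rowLen_lt h.le le_rfl⟩, ?_⟩
  rintro ⟨s, c⟩ hc
  obtain ⟨h1, h2⟩ := h.le_of_mem hc
  exact ⟨h2, (lam.rowLen_anti s j h2).trans (mem_cells_sdiff.1 hc).1⟩

theorem ribbonSign_eq (h : IsRibbonStep lam lam' i j) :
    ribbonSign (lam'.cells \ lam.cells) = (-1) ^ (j - i) := by
  have h1 : (lam'.cells \ lam.cells).image Prod.fst = Icc i j := by
    ext s
    rw [mem_image, mem_Icc]
    constructor
    · rintro ⟨⟨s, c⟩, hc, rfl⟩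
      exact h.le_of_mem hc
    · rintro ⟨h1, h2⟩
      exact ⟨(s, lam.rowLen s), mem_cells_sdiff.2 ⟨le_rfl, h.rowLen_lt h1 h2⟩, rfl⟩
  have := h.le
  rw [ribbonSign, h1, Nat.card_Icc]
  congr 1
  omega

theorem isRibbon (h : IsRibbonStep lam lam' i j) : IsRibbon (lam'.cells \ lam.cells) where
  skew := ⟨lam', lam, h.le_lam, rfl⟩
  connected := by
    have htail := h.isTail.1
    -- every cell but the tail has its left or lower neighbour in the ribbon
    have key : ∀ (n s c : ℕ) (hc : (s, c) ∈ lam'.cells \ lam.cells), (j - s) + c = n →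
        ((SimpleGraph.hasse (ℕ × ℕ)).induce
          ((lam'.cells \ lam.cells : Finset (ℕ × ℕ)) : Set (ℕ × ℕ))).Reachable
          ⟨(s, c), hc⟩ ⟨(j, lam.rowLen j), htail⟩ := by
      intro n
      induction n with
      | zero =>
        intro s c hc hn
        obtain ⟨h1, h2⟩ := h.le_of_mem hc
        have h3 := mem_cells_sdiff.1 hc
        obtain rfl : s = j := by omega
        obtain rfl : c = lam.rowLen s := by omega
        exact .refl _
      | succ n ih =>
        intro s c hc hn
        obtain ⟨h1, h2⟩ := h.le_of_mem hc
        have h3 := mem_cells_sdiff.1 hc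
        by_cases hcs : lam.rowLen s < c
        · obtain ⟨c, rfl⟩ : ∃ d, c = d + 1 := ⟨c - 1, by omega⟩
          have hc' : (s, c) ∈ lam'.cells \ lam.cells :=
            mem_cells_sdiff.2 ⟨by omega, by omega⟩
          refine SimpleGraph.Reachable.trans (SimpleGraph.Adj.reachable ?_)
            (ih s c hc' (by omega))
          rw [SimpleGraph.comap_adj, SimpleGraph.hasse_adj]
          right
          simp [Prod.mk_covBy_mk_iff]
        · obtain rfl : c = lam.rowLen s := by omega
          rcases h2.eq_or_lt with rfl | h2
          · exact .refl _
          have hc' : (s + 1, lam.rowLen s) ∈ lam'.cells \ lam.cells := by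
            refine mem_cells_sdiff.2 ⟨lam.rowLen_anti s (s + 1) (by omega), ?_⟩
            rw [h.mid s h1 h2]
            omega
          refine SimpleGraph.Reachable.trans (SimpleGraph.Adj.reachable ?_)
            (ih (s + 1) _ hc' (by omega))
          rw [SimpleGraph.comap_adj, SimpleGraph.hasse_adj]
          left
          simp [Prod.mk_covBy_mk_iff]
    have : Nonempty ((lam'.cells \ lam.cells : Finset (ℕ × ℕ)) : Set (ℕ × ℕ)) :=
      ⟨⟨_, htail⟩⟩
    refine ⟨fun a b => ?_⟩
    exact (key _ a.1.1 a.1.2 a.2 rfl).trans (key _ b.1.1 b.1.2 b.2 rfl).symm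
  no_square := by
    rintro s c ⟨h1, h2, h3, h4⟩
    rw [mem_cells_sdiff] at h1 h4
    have h5 := h.le_of_mem h2
    have h6 := h.le_of_mem h3
    have := h.mid s h6.1 (by omega)
    omega

/-- A ribbon that can be added to `lam` is given by its first and its last row. -/
theorem of_isRibbon (hle : lam ≤ lam') (hS : IsRibbon (lam'.cells \ lam.cells)) {c : ℕ}
    (ht : IsTail (lam'.cells \ lam.cells) (j, c)) :
    c = lam.rowLen j ∧ ∃ i, IsRibbonStep lam lam' i j := by
  classical
  have hj := mem_cells_sdiff.1 ht.1
  have hc : c = lam.rowLen j := by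
    have h1 : (j, lam.rowLen j) ∈ lam'.cells \ lam.cells :=
      mem_cells_sdiff.2 ⟨le_rfl, by omega⟩
    exact le_antisymm (ht.2 _ h1).2 hj.1
  have hex : ∃ i, lam.rowLen i < lam'.rowLen i := ⟨j, by omega⟩
  have hbelow (s : ℕ) (hs : j < s) : lam'.rowLen s = lam.rowLen s := by
    by_contra h
    have h1 := rowLen_le_of_le hle s
    have h2 := (ht.2 (s, lam.rowLen s) (mem_cells_sdiff.2 ⟨le_rfl, by omega⟩)).1
    dsimp only at h2
    omega
  have hij : Nat.find hex ≤ j := Nat.find_min' hex (by omega)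
  -- by connectedness, two consecutive rows of the ribbon share a column
  have hcross (s : ℕ) (h1 : Nat.find hex ≤ s) (h2 : s < j) :
      lam.rowLen s < lam'.rowLen (s + 1) := by
    by_contra hno
    let G := (SimpleGraph.hasse (ℕ × ℕ)).induce
      ((lam'.cells \ lam.cells : Finset (ℕ × ℕ)) : Set (ℕ × ℕ))
    have hstep : ∀ a b, G.Adj a b → a.1.1 ≤ s → b.1.1 ≤ s := by
      rintro ⟨⟨a, a'⟩, ha⟩ ⟨⟨b, b'⟩, hb⟩ hab has
      have ha' := mem_cells_sdiff.1 ha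
      have hb' := mem_cells_sdiff.1 hb
      rw [SimpleGraph.comap_adj, SimpleGraph.hasse_adj] at hab
      simp only [Function.Embedding.subtype_apply, Prod.mk_covBy_mk_iff, Nat.covBy_iff_add_one_eq]
        at hab
      dsimp only at has ⊢
      by_contra hbs
      obtain ⟨rfl, rfl, rfl⟩ : a = s ∧ b = s + 1 ∧ a' = b' := by omega
      omega
    have hreach : ∀ a b, G.Reachable a b → a.1.1 ≤ s → b.1.1 ≤ s := by
      rintro a b ⟨p⟩
      induction p with
      | nil => exact id
      | cons hab _ ih => exact fun h => ih (hstep _ _ hab h)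
    have h3 := hreach ⟨(Nat.find hex, lam.rowLen (Nat.find hex)),
        mem_cells_sdiff.2 ⟨le_rfl, Nat.find_spec hex⟩⟩ ⟨(j, c), ht.1⟩
      (hS.connected.preconnected _ _) h1
    dsimp only at h3
    omega
  refine ⟨hc, Nat.find hex, hij, Nat.find_spec hex, fun s h1 h2 => ?_, fun s hs => ?_, hbelow⟩
  · have h3 := hcross s h1 h2
    by_contra hne
    have h4 := lam'.rowLen_anti s (s + 1) (by omega)
    have h5 := lam.rowLen_anti s (s + 1) (by omega)
    -- otherwise the rows `s` and `s + 1` share two columns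
    refine hS.no_square s (lam.rowLen s) ⟨?_, ?_, ?_, ?_⟩ <;> rw [mem_cells_sdiff] <;> omega
  · have h1 := Nat.find_min hex hs
    have h2 := rowLen_le_of_le hle s
    omega

end IsRibbonStep

/-- In terms of `lam + δ`: the entries in the rows of the ribbon above its tail are smaller than
the increased entry of the tail row. Together with `IsRibbonStep.lt_rowLen_add` this shows that the
first row of the ribbon is determined by its size and its last row. -/
theorem IsRibbonStep.rowLen_add_lt {lam lam' : YoungDiagram} {i j k : ℕ}
    (h : IsRibbonStep lam lam' i j) (hk : lam'.rowLen i + (j - i) = lam.rowLen j + k) {s : ℕ}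
    (h1 : i ≤ s) (h2 : s < j) : lam.rowLen s + j < lam.rowLen j + k + s := by
  have h3 := h.mid s h1 h2
  have h4 := lam'.rowLen_anti i (s + 1) (by omega)
  omega

theorem IsRibbonStep.lt_rowLen_add {lam lam' : YoungDiagram} {i j k : ℕ}
    (h : IsRibbonStep lam lam' i j) (hk : lam'.rowLen i + (j - i) = lam.rowLen j + k) {s : ℕ}
    (h1 : s < i) : lam.rowLen j + k + s < lam.rowLen s + j := by
  have h2 := h.le
  have h3 := h.above s h1
  have h4 := lam'.rowLen_anti s i h1.le
  omega

theorem IsRibbonStepOfSize.unique {lam lam' lam'' : YoungDiagram} {j k : ℕ}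
    (h' : IsRibbonStepOfSize lam j k lam') (h'' : IsRibbonStepOfSize lam j k lam'') :
    lam' = lam'' := by
  obtain ⟨i', h', hk'⟩ := h'
  obtain ⟨i'', h'', hk''⟩ := h''
  have le' := h'.le
  have le'' := h''.le
  obtain rfl : i' = i'' := by
    rcases lt_trichotomy i' i'' with hlt | heq | hlt
    · have h1 := h''.lt_rowLen_add hk'' hlt
      have h2 := h'.rowLen_add_lt hk' le_rfl (by omega)
      omega
    · exact heq
    · have h1 := h'.lt_rowLen_add hk' hlt
      have h2 := h''.rowLen_add_lt hk'' le_rfl (by omega)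
      omega
  refine rowLen_ext fun s => ?_
  rcases lt_trichotomy s i' with h1 | rfl | h1
  · rw [h'.above s h1, h''.above s h1]
  · omega
  · rcases lt_or_ge j s with h2 | h2
    · rw [h'.below s h2, h''.below s h2]
    · obtain ⟨s, rfl⟩ : ∃ t, s = t + 1 := ⟨s - 1, by omega⟩
      rw [h'.mid s (by omega) (by omega), h''.mid s (by omega) (by omega)]

/-- A ribbon of size `k` with tail in row `j` can be added, unless the increased entry `j` of
`lam + δ` equals another entry. -/
theorem exists_isRibbonStepOfSize (lam : YoungDiagram) {j k : ℕ} (hk : 0 < k)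
    (h : ∀ s, s < j → lam.rowLen s + j ≠ lam.rowLen j + k + s) :
    ∃ lam', IsRibbonStepOfSize lam j k lam' := by
  classical
  have hex : ∃ s, lam.rowLen s + j ≤ lam.rowLen j + k + s := ⟨j, by omega⟩
  have hmin (s : ℕ) (hs : s < Nat.find hex) := Nat.find_min hex hs
  have hi := Nat.find_spec hex
  have hij : Nat.find hex ≤ j := Nat.find_min' hex (by omega)
  generalize Nat.find hex = i at hmin hi hij
  have hanti (s : ℕ) := lam.rowLen_anti s (s + 1) (by omega)
  have hi' : lam.rowLen i + j < lam.rowLen j + k + i := by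
    rcases hij.eq_or_lt with rfl | hij
    · omega
    · have := h i hij
      omega
  -- in `lam + δ`, the increased entry `j` moves to row `i`, and the entries `i, …, j - 1` move
  -- down by one row
  let f (s : ℕ) : ℕ := if s < i then lam.rowLen s else if s = i then lam.rowLen j + k - (j - i)
    else if s ≤ j then lam.rowLen (s - 1) + 1 else lam.rowLen s
  have hf : Antitone f := by
    refine antitone_nat_of_succ_le fun s => ?_
    have h1 := hanti s
    have h2 := hanti (s - 1)
    have h3 := lam.rowLen_anti i j hij
    dsimp only [f]
    rcases lt_trichotomy (s + 1) i with hs | hs | hs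
    · rw [if_pos hs, if_pos (by omega)]
      exact h1
    · have h4 := hmin s (by omega)
      rw [if_neg (by omega), if_pos hs, if_pos (by omega)]
      omega
    · rw [if_neg (show ¬ s + 1 < i by omega), if_neg (show ¬ s + 1 = i by omega),
        if_neg (show ¬ s < i by omega), Nat.add_sub_cancel]
      rcases eq_or_ne s i with rfl | hsi
      · rw [if_pos rfl]
        split_ifs
        all_goals omega
      · have h5 : s - 1 + 1 = s := by omega
        rw [h5] at h2
        rw [if_neg hsi]
        split_ifs
        all_goals omega
  have hf0 : f (max (j + 1) (lam.colLen 0)) = 0 := by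
    have h1 := le_max_left (j + 1) (lam.colLen 0)
    have h2 := le_max_right (j + 1) (lam.colLen 0)
    dsimp only [f]
    rw [if_neg (by omega), if_neg (by omega), if_neg (by omega), rowLen_eq_zero h2]
  obtain ⟨lam', hlam'⟩ := exists_rowLen_eq f hf _ hf0
  have hfi : lam'.rowLen i = lam.rowLen j + k - (j - i) := by
    rw [hlam']
    dsimp only [f]
    rw [if_neg (by omega), if_pos rfl]
  refine ⟨lam', i, ⟨hij, by omega, fun s h1 h2 => ?_, fun s hs => ?_, fun s hs => ?_⟩, by omega⟩
  · rw [hlam']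
    dsimp only [f]
    rw [if_neg (by omega), if_neg (by omega), if_pos (by omega), Nat.add_sub_cancel]
  · rw [hlam']
    dsimp only [f]
    rw [if_pos hs]
  · rw [hlam']
    dsimp only [f]
    rw [if_neg (by omega), if_neg (by omega), if_neg (by omega)]

/-! ### Ribbons and alternants -/

/-- Adding a ribbon with tail in row `j` means to increase the entry `j` of `lam + δ`, and to sort
the result with a cycle. -/
theorem IsRibbonStep.shiftedParts_comp {lam lam' : YoungDiagram} {i j k N : ℕ}
    (h : IsRibbonStep lam lam' i j) (hk : lam'.rowLen i + (j - i) = lam.rowLen j + k)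
    (hj : j < N) :
    shiftedParts N lam' ∘ Fin.cycleIcc ⟨i, h.le.trans_lt hj⟩ ⟨j, hj⟩ =
      shiftedParts N lam + Pi.single ⟨j, hj⟩ k := by
  have hij := h.le
  have : NeZero N := ⟨by omega⟩
  funext s
  have hs := s.isLt
  simp only [Function.comp_apply, Pi.add_apply]
  by_cases h1 : (s : ℕ) < i
  · rw [Fin.cycleIcc_of_lt (Fin.lt_def.2 h1), Pi.single_eq_of_ne
      (fun h => by rw [h] at h1; dsimp only at h1; omega), add_zero, shiftedParts,
      shiftedParts, h.above _ h1]
  by_cases h2 : j < (s : ℕ)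
  · rw [Fin.cycleIcc_of_gt (Fin.lt_def.2 h2), Pi.single_eq_of_ne
      (fun h => by rw [h] at h2; dsimp only at h2; omega), add_zero, shiftedParts,
      shiftedParts, h.below _ h2]
  by_cases h3 : (s : ℕ) = j
  · obtain rfl : s = ⟨j, hj⟩ := Fin.ext h3
    rw [Fin.cycleIcc_of_last (Fin.le_def.2 hij), Pi.single_eq_same, shiftedParts, shiftedParts,
      staircase, staircase]
    dsimp only
    omega
  · have hlt : (s : ℕ) < j := by omega
    have h4 : ((s + 1 : Fin N) : ℕ) = s + 1 := Fin.val_add_one_of_lt' (by omega)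
    rw [Fin.cycleIcc_of_ge_of_lt (Fin.le_def.2 (not_lt.1 h1)) (Fin.lt_def.2 hlt),
      Pi.single_eq_of_ne (fun h => h3 (congrArg Fin.val h)), add_zero, shiftedParts,
      shiftedParts, staircase, staircase, h4, h.mid s (by omega) hlt]
    omega

theorem val_cycleIcc_le_iff {i j N : ℕ} (hij : i ≤ j) (hj : j < N) (s : Fin N) :
    ((Fin.cycleIcc ⟨i, hij.trans_lt hj⟩ ⟨j, hj⟩ s : Fin N) : ℕ) ≤ j ↔ (s : ℕ) ≤ j := by
  have : NeZero N := ⟨by omega⟩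
  by_cases h1 : (s : ℕ) < i
  · rw [Fin.cycleIcc_of_lt (Fin.lt_def.2 h1)]
  by_cases h2 : j < (s : ℕ)
  · rw [Fin.cycleIcc_of_gt (Fin.lt_def.2 h2)]
  by_cases h3 : (s : ℕ) = j
  · obtain rfl : s = ⟨j, hj⟩ := Fin.ext h3
    rw [Fin.cycleIcc_of_last (Fin.le_def.2 hij)]
    simp [hij]
  · have h4 : ((s + 1 : Fin N) : ℕ) = s + 1 := Fin.val_add_one_of_lt' (by omega)
    rw [Fin.cycleIcc_of_ge_of_lt (Fin.le_def.2 (not_lt.1 h1)) (Fin.lt_def.2 (by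
      dsimp only; omega)), h4]
    omega

theorem IsRibbonStep.card_eq {lam lam' : YoungDiagram} {i j k : ℕ}
    (h : IsRibbonStep lam lam' i j) (hk : lam'.rowLen i + (j - i) = lam.rowLen j + k) :
    #(lam'.cells \ lam.cells) = k := by
  obtain ⟨N, h1, h2, h3⟩ : ∃ N, lam.colLen 0 ≤ N ∧ lam'.colLen 0 ≤ N ∧ j < N :=
    ⟨max (max (lam.colLen 0) (lam'.colLen 0)) (j + 1), by omega, by omega, by omega⟩
  -- compare the sums of the entries of `lam' + δ` and of `lam + δ`
  have h4 := congrArg (fun f : Fin N → ℕ => ∑ s, f s) (h.shiftedParts_comp hk h3)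
  simp only [Function.comp_apply, Pi.add_apply, Finset.sum_add_distrib] at h4
  rw [Equiv.sum_comp _ (shiftedParts N lam')] at h4
  simp only [shiftedParts, Finset.sum_add_distrib] at h4
  rw [← card_cells_eq_sum_rowLen h1, ← card_cells_eq_sum_rowLen h2] at h4
  rw [Finset.card_sdiff_of_subset (YoungDiagram.cells_subset_iff.2 h.le_lam)]
  simp at h4
  omega

theorem IsRibbonStepOfSize.of_isRibbon {lam lam' : YoungDiagram} {j c : ℕ} (hle : lam ≤ lam')
    (hS : IsRibbon (lam'.cells \ lam.cells)) (ht : IsTail (lam'.cells \ lam.cells) (j, c)) :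
    IsRibbonStepOfSize lam j #(lam'.cells \ lam.cells) lam' := by
  obtain ⟨-, i, hi⟩ := IsRibbonStep.of_isRibbon hle hS ht
  have h1 : lam'.rowLen i + (j - i) =
      lam.rowLen j + (lam'.rowLen i + (j - i) - lam.rowLen j) := by
    have := hi.top
    have := lam.rowLen_anti i j hi.le
    omega
  refine ⟨i, hi, ?_⟩
  rw [hi.card_eq h1]
  exact h1

open Classical in
/-- Increasing the entry `j` of `lam + δ` by `k` either means to add a ribbon, or creates two equal
entries. -/
theorem wordAlternant_add_single {r N : ℕ} (μ : Fin r → ℕ) (lam : YoungDiagram) {k : ℕ}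
    (hk : 0 < k) (j : Fin N) :
    wordAlternant μ j (shiftedParts N lam + Pi.single j k) =
      if h : ∃ lam', IsRibbonStepOfSize lam j k lam' then
        ribbonSign (h.choose.cells \ lam.cells) • wordAlternant μ j (shiftedParts N h.choose)
      else 0 := by
  split_ifs with h
  · obtain ⟨i, hi, hik⟩ := h.choose_spec
    rw [← hi.shiftedParts_comp hik j.isLt,
      wordAlternant_comp _ _ _ _ (val_cycleIcc_le_iff hi.le j.isLt),
      Fin.sign_cycleIcc_of_le (Fin.le_def.2 hi.le), hi.ribbonSign_eq, Units.smul_def]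
    simp
  · have h1 : ∃ s, s < (j : ℕ) ∧ lam.rowLen s + j = lam.rowLen j + k + s := by
      by_contra hne
      push Not at hne
      exact h (exists_isRibbonStepOfSize lam hk hne)
    obtain ⟨s, hs, hs'⟩ := h1
    have hj := j.isLt
    have hne : (⟨s, by omega⟩ : Fin N) ≠ j := fun h => by
      have := congrArg Fin.val h
      dsimp only at this
      omega
    refine wordAlternant_eq_zero μ j _ hne hs.le le_rfl ?_
    simp only [Pi.add_apply, Pi.single_eq_of_ne hne, Pi.single_eq_same, shiftedParts, staircase]
    omega

/-! ### Iterated addition of ribbons -/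

open Classical in
/-- The signed sum of the alternants of the partitions that arise from `lam` by adding ribbons of
the given sizes, with tails in rows `J ≥ j₁ ≥ j₂ ≥ ⋯` with `j₁ < N`. -/
def ribbonSum (N : ℕ) : List ℕ → ℕ → YoungDiagram → MvPolynomial (Fin N) ℂ
  | [], _, lam => alternant N (shiftedParts N lam)
  | k :: L, J, lam => ∑ j ∈ univ.filter (fun j : Fin N => (j : ℕ) ≤ J),
      if h : ∃ lam', IsRibbonStepOfSize lam j k lam' then
        ribbonSign (h.choose.cells \ lam.cells) • ribbonSum N L j h.choose
      else 0

/-- The first block is added to a position `j ≤ J`; by `wordAlternant_add_single` this is the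
addition of a ribbon with tail in row `j`, and the remaining blocks go to positions `≤ j`. -/
theorem wordAlternant_eq_sum_ribbonSum {r N : ℕ} (μ : Fin r → ℕ) (hpos : ∀ i, 0 < μ i) (J : ℕ)
    (lam : YoungDiagram) :
    wordAlternant μ J (shiftedParts N lam) =
      ∑ π : Equiv.Perm (Fin r), ribbonSum N (List.ofFn (μ ∘ π)) J lam := by
  induction r generalizing J lam with
  | zero =>
    rw [wordAlternant, Finset.filter_true_of_mem (fun g _ t => t.elim0),
      Fintype.sum_unique, Fintype.sum_unique]
    have h : content μ (default : Fin 0 → Fin N) = 0 := by simp [content]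
    rw [h, add_zero, Finset.filter_true_of_mem (fun σ _ => Subsingleton.elim _ _)]
    simp [ribbonSum]
  | succ r ih =>
    rw [wordAlternant_succ, ← Equiv.sum_comp Equiv.Perm.decomposeFin.symm,
      Fintype.sum_prod_type]
    refine Finset.sum_congr rfl fun a _ => ?_
    have hlist (e : Equiv.Perm (Fin r)) :
        List.ofFn (μ ∘ Equiv.Perm.decomposeFin.symm (a, e)) =
          μ a :: List.ofFn ((fun t : Fin r => μ (Equiv.swap 0 a t.succ)) ∘ e) := by
      rw [List.ofFn_succ]
      simp [Function.comp_def]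
    simp only [hlist, ribbonSum]
    rw [Finset.sum_comm]
    refine Finset.sum_congr rfl fun j _ => ?_
    rw [wordAlternant_add_single _ _ (hpos a)]
    split_ifs with h
    · rw [ih _ (fun t => hpos _), Finset.smul_sum]
    · simp

/-! ### Monotonic ribbon tilings -/

theorem IsTail.unique {S : Finset (ℕ × ℕ)} {c d : ℕ × ℕ} (hc : IsTail S c) (hd : IsTail S d) :
    c = d := by
  have h1 := hc.2 d hd.1
  have h2 := hd.2 c hc.1
  exact Prod.ext (by omega) (by omega)

theorem IsTail.sup_fst {S : Finset (ℕ × ℕ)} {c : ℕ × ℕ} (hc : IsTail S c) :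
    S.sup Prod.fst = c.1 :=
  le_antisymm (Finset.sup_le fun d hd => (hc.2 d hd).1) (Finset.le_sup (f := Prod.fst) hc.1)

theorem biUnion_filter_castSucc {α : Type*} [DecidableEq α] {k : ℕ}
    (f : Fin (k + 1) → Finset α) {l : ℕ} (hl : l ≤ k) :
    (univ.filter fun i : Fin (k + 1) => (i : ℕ) < l).biUnion f =
      (univ.filter fun i : Fin k => (i : ℕ) < l).biUnion fun i => f i.castSucc := by
  ext c
  simp only [mem_biUnion, mem_filter, mem_univ, true_and]
  constructor
  · rintro ⟨i, hi, hc⟩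
    exact ⟨⟨i, hi.trans_le hl⟩, hi, hc⟩
  · rintro ⟨i, hi, hc⟩
    exact ⟨i.castSucc, hi, hc⟩

theorem biUnion_univ_succ {α : Type*} [DecidableEq α] {k : ℕ} (f : Fin (k + 1) → Finset α) :
    univ.biUnion f = (univ.biUnion fun i : Fin k => f i.castSucc) ∪ f (Fin.last k) := by
  ext c
  simp only [mem_biUnion, mem_union, mem_univ, true_and, Fin.exists_fin_succ']

namespace MonotonicRibbonTiling

variable {k : ℕ}

theorem ext_ribbon {T T' : MonotonicRibbonTiling k} (h : ∀ i, T.ribbon i = T'.ribbon i) :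
    T = T' := by
  have h' : T.ribbon = T'.ribbon := funext h
  refine MonotonicRibbonTiling.ext (YoungDiagram.ext ?_) h'
  rw [← T.union_eq, ← T'.union_eq, h']

theorem ribbon_subset (T : MonotonicRibbonTiling k) (i : Fin k) :
    T.ribbon i ⊆ T.shape.cells := by
  rw [← T.union_eq]
  exact Finset.subset_biUnion_of_mem T.ribbon (mem_univ i)

/-- Removing the last ribbon. -/
def init (T : MonotonicRibbonTiling (k + 1)) : MonotonicRibbonTiling k where
  shape := (T.initial k k.le_succ).choose
  ribbon i := T.ribbon i.castSucc
  isRibbon i := T.isRibbon _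
  disjoint i j hij := T.disjoint _ _ fun h => hij (Fin.castSucc_injective _ h)
  union_eq := by
    rw [← (T.initial k k.le_succ).choose_spec, biUnion_filter_castSucc _ le_rfl,
      Finset.filter_true_of_mem fun i _ => i.isLt]
  tails := by
    obtain ⟨c, h1, h2⟩ := T.tails
    exact ⟨fun i => c i.castSucc, fun i => h1 _, h2.comp Fin.strictMono_castSucc⟩
  initial l hl := by
    obtain ⟨nu, hnu⟩ := T.initial l (hl.trans k.le_succ)
    exact ⟨nu, by rw [← hnu, biUnion_filter_castSucc _ hl]⟩

theorem shape_cells_eq (T : MonotonicRibbonTiling (k + 1)) :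
    T.shape.cells = T.init.shape.cells ∪ T.ribbon (Fin.last k) := by
  rw [← T.union_eq, ← T.init.union_eq, biUnion_univ_succ]
  rfl

theorem init_shape_le (T : MonotonicRibbonTiling (k + 1)) : T.init.shape ≤ T.shape := by
  rw [← YoungDiagram.cells_subset_iff, shape_cells_eq]
  exact subset_union_left

theorem ribbon_last (T : MonotonicRibbonTiling (k + 1)) :
    T.ribbon (Fin.last k) = T.shape.cells \ T.init.shape.cells := by
  rw [shape_cells_eq, Finset.union_sdiff_cancel_left]
  rw [← T.init.union_eq, Finset.disjoint_biUnion_left]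
  exact fun i _ => T.disjoint _ _ (Fin.castSucc_lt_last i).ne

/-- The row of the tail of the last ribbon, or `N` if there is no ribbon. -/
def lastRow (N : ℕ) : {k : ℕ} → MonotonicRibbonTiling k → ℕ
  | 0, _ => N
  | _ + 1, T => (T.ribbon (Fin.last _)).sup Prod.fst

/-- The tail columns keep increasing if and only if the tail rows weakly decrease. -/
theorem forall_tail_lt_iff (T : MonotonicRibbonTiling k) {N j : ℕ} (hj : j < N) :
    (∀ i c, IsTail (T.ribbon i) c → c.2 < T.shape.rowLen j) ↔ j ≤ T.lastRow N := by
  cases k with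
  | zero => exact ⟨fun _ => hj.le, fun _ i => i.elim0⟩
  | succ k =>
    obtain ⟨c, hc, hmono⟩ := T.tails
    have hrow : T.lastRow N = (c (Fin.last k)).1 := (hc _).sup_fst
    rw [hrow]
    have hlast := (hc (Fin.last k)).1
    constructor
    · intro h
      by_contra hlt
      have h1 : (j, (c (Fin.last k)).2) ∈ T.shape.cells :=
        YoungDiagram.mem_iff_lt_rowLen.2 (h _ _ (hc _))
      have h2 : (j, (c (Fin.last k)).2) ∉ T.ribbon (Fin.last k) := fun h2 =>
        hlt ((hc _).2 _ h2).1
      rw [ribbon_last, mem_sdiff, not_and_not_right] at h2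
      rw [ribbon_last, mem_sdiff] at hlast
      exact hlast.2 (T.init.shape.up_left_mem (not_le.1 hlt).le le_rfl (h2 h1))
    · intro h i d hd
      rw [hd.unique (hc i)]
      refine (hmono.monotone (Fin.le_last i)).trans_lt ?_
      rw [← YoungDiagram.mem_iff_lt_rowLen]
      exact T.shape.up_left_mem h le_rfl (T.ribbon_subset _ hlast)

/-- A monotonic ribbon tiling is extended by adding a ribbon to its shape, with the tail in a column
to the right of all the others. -/
theorem exists_snoc (T : MonotonicRibbonTiling k) {lam' : YoungDiagram} {i j : ℕ}
    (h : IsRibbonStep T.shape lam' i j)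
    (htail : ∀ i c, IsTail (T.ribbon i) c → c.2 < T.shape.rowLen j) :
    ∃ T' : MonotonicRibbonTiling (k + 1), T'.shape = lam' ∧ T'.init = T := by
  let f : Fin (k + 1) → Finset (ℕ × ℕ) :=
    Fin.snoc (α := fun _ => Finset (ℕ × ℕ)) T.ribbon (lam'.cells \ T.shape.cells)
  have hf (i : Fin k) : f i.castSucc = T.ribbon i := Fin.snoc_castSucc ..
  have hlast : f (Fin.last k) = lam'.cells \ T.shape.cells := Fin.snoc_last ..
  have hdisj (i : Fin k) : Disjoint (T.ribbon i) (lam'.cells \ T.shape.cells) :=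
    Finset.disjoint_sdiff.mono_left (T.ribbon_subset i)
  have hunion : univ.biUnion f = lam'.cells := by
    rw [biUnion_univ_succ, hlast]
    simp only [hf]
    rw [T.union_eq, Finset.union_sdiff_of_subset (YoungDiagram.cells_subset_iff.2 h.le_lam)]
  let T' : MonotonicRibbonTiling (k + 1) :=
    { shape := lam'
      ribbon := f
      isRibbon := by
        intro i
        induction i using Fin.lastCases with
        | last => rw [hlast]; exact h.isRibbon
        | cast i => rw [hf]; exact T.isRibbon i
      disjoint := by
        intro a b hab
        induction a using Fin.lastCases with
        | last =>
          induction b using Fin.lastCases with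
          | last => exact absurd rfl hab
          | cast b => rw [hf, hlast]; exact (hdisj b).symm
        | cast a =>
          induction b using Fin.lastCases with
          | last => rw [hf, hlast]; exact hdisj a
          | cast b =>
            rw [hf, hf]
            exact T.disjoint a b fun h => hab (by rw [h])
      union_eq := hunion
      tails := by
        obtain ⟨c, hc, hmono⟩ := T.tails
        refine ⟨Fin.snoc (α := fun _ => ℕ × ℕ) c (j, T.shape.rowLen j), fun i => ?_, ?_⟩
        · induction i using Fin.lastCases with
          | last => rw [hlast, Fin.snoc_last]; exact h.isTail
          | cast i => rw [hf, Fin.snoc_castSucc]; exact hc i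
        · intro a b hab
          induction b using Fin.lastCases with
          | last =>
            induction a using Fin.lastCases with
            | last => exact absurd hab (lt_irrefl _)
            | cast a =>
              simp only [Fin.snoc_last, Fin.snoc_castSucc]
              exact htail a _ (hc a)
          | cast b =>
            induction a using Fin.lastCases with
            | last => exact absurd hab (Fin.castSucc_lt_last b).not_gt
            | cast a =>
              simp only [Fin.snoc_castSucc]
              exact hmono (Fin.castSucc_lt_castSucc_iff.1 hab)
      initial := by
        intro l hl
        rcases hl.eq_or_lt with rfl | hl
        · refine ⟨lam', ?_⟩
          rw [Finset.filter_true_of_mem fun i _ => i.isLt, hunion]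
        · obtain ⟨nu, hnu⟩ := T.initial l (Nat.lt_succ_iff.1 hl)
          refine ⟨nu, ?_⟩
          rw [biUnion_filter_castSucc _ (Nat.lt_succ_iff.1 hl), ← hnu]
          simp only [hf] }
  exact ⟨T', rfl, ext_ribbon hf⟩

theorem card_shape (T : MonotonicRibbonTiling k) : #T.shape.cells = ∑ i, #(T.ribbon i) := by
  rw [← T.union_eq, Finset.card_biUnion fun i _ j _ hij => T.disjoint i j hij]

theorem lt_of_mem_shape (T : MonotonicRibbonTiling k) {c : ℕ × ℕ} (hc : c ∈ T.shape) :
    c.1 < ∑ i, #(T.ribbon i) := by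
  rw [← card_shape]
  refine (YoungDiagram.mem_iff_lt_colLen.1 hc).trans_le ?_
  rw [YoungDiagram.colLen_eq_card]
  exact Finset.card_le_card (Finset.filter_subset _ _)

theorem colLen_shape_le (T : MonotonicRibbonTiling k) :
    T.shape.colLen 0 ≤ ∑ i, #(T.ribbon i) := by
  rw [← card_shape, YoungDiagram.colLen_eq_card]
  exact Finset.card_le_card (Finset.filter_subset _ _)

theorem sign_succ (T : MonotonicRibbonTiling (k + 1)) :
    T.sign = T.init.sign * ribbonSign (T.shape.cells \ T.init.shape.cells) := by
  rw [← ribbon_last]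
  exact Fin.prod_univ_castSucc _

/-- The last ribbon of a tiling, as a ribbon that is added to the union of the others. -/
theorem isRibbonStepOfSize_lastRow (T : MonotonicRibbonTiling (k + 1)) (N : ℕ) :
    IsRibbonStepOfSize T.init.shape (T.lastRow N) #(T.ribbon (Fin.last k)) T.shape := by
  obtain ⟨c, hc, -⟩ := T.tails
  have hrow : T.lastRow N = (c (Fin.last k)).1 := (hc _).sup_fst
  have h1 := T.isRibbon (Fin.last k)
  have h2 := hc (Fin.last k)
  rw [ribbon_last] at h1 h2 ⊢
  rw [hrow]
  exact IsRibbonStepOfSize.of_isRibbon T.init_shape_le h1 h2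

theorem lastRow_lt (T : MonotonicRibbonTiling (k + 1)) (N : ℕ) :
    T.lastRow N < ∑ i, #(T.ribbon i) := by
  obtain ⟨c, hc, -⟩ := T.tails
  have hrow : T.lastRow N = (c (Fin.last k)).1 := (hc _).sup_fst
  rw [hrow]
  exact T.lt_of_mem_shape (T.ribbon_subset _ (hc _).1)

theorem lastRow_le_lastRow_init (T : MonotonicRibbonTiling (k + 1)) {N : ℕ}
    (hN : T.lastRow N < N) : T.lastRow N ≤ T.init.lastRow N := by
  rw [← forall_tail_lt_iff _ hN]
  obtain ⟨c, hc, hmono⟩ := T.tails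
  have hrow : T.lastRow N = (c (Fin.last k)).1 := (hc _).sup_fst
  intro i d hd
  have h1 := T.isRibbon (Fin.last k)
  have h2 := hc (Fin.last k)
  rw [ribbon_last] at h1 h2
  rw [hrow, ← (IsRibbonStep.of_isRibbon (j := (c (Fin.last k)).1) T.init_shape_le h1 h2).1,
    IsTail.unique hd (hc i.castSucc)]
  exact hmono (Fin.castSucc_lt_last i)

end MonotonicRibbonTiling

/-- The monotonic ribbon tilings with ribbons of sizes `ν 0, ν 1, …`, in this order. -/
def tilingsOfSizes {k : ℕ} (ν : Fin k → ℕ) : Finset (MonotonicRibbonTiling k) :=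
  (tilings ν).filter fun T => ∀ i, #(T.ribbon i) = ν i

theorem mem_tilingsOfSizes {k : ℕ} {ν : Fin k → ℕ} {T : MonotonicRibbonTiling k} :
    T ∈ tilingsOfSizes ν ↔ ∀ i, #(T.ribbon i) = ν i := by
  rw [tilingsOfSizes, mem_filter, tilings, Set.Finite.mem_toFinset]
  exact ⟨fun h => h.2, fun h => ⟨⟨1, h⟩, h⟩⟩

/-- The tiling without ribbons. -/
def emptyTiling : MonotonicRibbonTiling 0 where
  shape := ⊥
  ribbon i := i.elim0
  isRibbon i := i.elim0
  disjoint i := i.elim0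
  union_eq := by simp
  tails := ⟨fun i => i.elim0, fun i => i.elim0, fun i => i.elim0⟩
  initial _ _ := ⟨⊥, by simp⟩

/-- Iterated additions of ribbons to the empty partition are monotonic ribbon tilings. The list `L`
of ribbons still to be added makes an induction on the number `k` of ribbons already added work. -/
theorem ribbonSum_ofFn_append {k : ℕ} (N : ℕ) (ν : Fin k → ℕ) (hN : ∑ i, ν i ≤ N)
    (L : List ℕ) :
    ribbonSum N (List.ofFn ν ++ L) N ⊥ =
      ∑ T ∈ tilingsOfSizes ν, T.sign • ribbonSum N L (T.lastRow N) T.shape := by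
  classical
  induction k generalizing L with
  | zero =>
    have h : tilingsOfSizes ν = {emptyTiling} := by
      ext T
      rw [mem_tilingsOfSizes, mem_singleton]
      exact ⟨fun _ => MonotonicRibbonTiling.ext_ribbon fun i => i.elim0, fun _ i => i.elim0⟩
    rw [h, Finset.sum_singleton]
    simp [MonotonicRibbonTiling.sign, MonotonicRibbonTiling.lastRow, emptyTiling]
  | succ k ih =>
    have hN' : ∑ i : Fin k, ν i.castSucc ≤ N := by
      rw [Fin.sum_univ_castSucc] at hN
      omega
    rw [List.ofFn_succ', List.concat_eq_append, List.append_assoc, List.singleton_append,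
      ih _ hN']
    simp only [ribbonSum, Finset.smul_sum, smul_dite, smul_zero]
    rw [Finset.sum_sigma', ← Finset.sum_filter_of_ne (p := fun x : Σ _ : MonotonicRibbonTiling k,
      Fin N => ∃ lam', IsRibbonStepOfSize x.1.shape x.2 (ν (Fin.last k)) lam')]
    swap
    · intro x _ hx
      by_contra hne
      exact hx (dif_neg hne)
    symm
    have hlt {T : MonotonicRibbonTiling (k + 1)} (hT : T ∈ tilingsOfSizes ν) :
        T.lastRow N < N := by
      refine (T.lastRow_lt N).trans_le (le_of_eq_of_le ?_ hN)
      exact Finset.sum_congr rfl fun i _ => mem_tilingsOfSizes.1 hT i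
    have hstep {T : MonotonicRibbonTiling (k + 1)} (hT : T ∈ tilingsOfSizes ν) :
        IsRibbonStepOfSize T.init.shape (T.lastRow N) (ν (Fin.last k)) T.shape := by
      rw [← mem_tilingsOfSizes.1 hT]
      exact T.isRibbonStepOfSize_lastRow N
    refine Finset.sum_bij (fun T hT => ⟨T.init, ⟨T.lastRow N, hlt hT⟩⟩) ?_ ?_ ?_ ?_
    · intro T hT
      rw [mem_filter, mem_sigma, mem_filter]
      refine ⟨⟨mem_tilingsOfSizes.2 fun i => mem_tilingsOfSizes.1 hT i.castSucc, mem_univ _,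
        T.lastRow_le_lastRow_init (hlt hT)⟩, T.shape, hstep hT⟩
    · intro T hT T' hT' h
      simp only [Sigma.mk.injEq, heq_eq_eq, Fin.mk.injEq] at h
      obtain ⟨h1, h2⟩ := h
      have h3 := hstep hT
      rw [h1, h2] at h3
      have h4 := h3.unique (hstep hT')
      refine MonotonicRibbonTiling.ext_ribbon fun i => ?_
      induction i using Fin.lastCases with
      | last => rw [T.ribbon_last, T'.ribbon_last, h1, h4]
      | cast i => exact congrFun (congrArg MonotonicRibbonTiling.ribbon h1) i
    · rintro ⟨T, j⟩ hTj
      rw [mem_filter, mem_sigma, mem_filter] at hTj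
      obtain ⟨⟨hT, -, hj⟩, lam', i, hi, hik⟩ := hTj
      dsimp only at hT hj hi hik
      obtain ⟨T', rfl, rfl⟩ := T.exists_snoc hi ((T.forall_tail_lt_iff j.isLt).2 hj)
      have hT' : T' ∈ tilingsOfSizes ν := by
        rw [mem_tilingsOfSizes] at hT ⊢
        intro s
        induction s using Fin.lastCases with
        | last => rw [T'.ribbon_last, hi.card_eq hik]
        | cast s => exact hT s
      refine ⟨T', hT', ?_⟩
      have hrow : T'.lastRow N = j := by
        have h1 := hi.isTail.sup_fst
        rw [← T'.ribbon_last] at h1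
        exact h1
      simp only [hrow]
    · intro T hT
      have hex : ∃ lam', IsRibbonStepOfSize T.init.shape (T.lastRow N) (ν (Fin.last k)) lam' :=
        ⟨_, hstep hT⟩
      have hshape : hex.choose = T.shape := hex.choose_spec.unique (hstep hT)
      rw [dif_pos hex, hshape, T.sign_succ, mul_smul]

/-! ### Orderings of the ribbon sizes -/

theorem multFactorial_eq_card {r : ℕ} (μ : Fin r → ℕ) (hpos : ∀ i, 0 < μ i) :
    multFactorial μ = #{σ : Equiv.Perm (Fin r) | μ ∘ σ = μ} := by
  rw [← Fintype.card_subtype, DomMulAct.stabilizer_card', multFactorial]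
  simp only [Fintype.card_subtype]
  symm
  refine Finset.prod_subset ?_ ?_
  · intro m hm
    obtain ⟨i, -, rfl⟩ := mem_image.1 hm
    exact mem_Icc.2 ⟨hpos i, Finset.single_le_sum (fun _ _ => Nat.zero_le _) (mem_univ i)⟩
  · intro m _ hm
    rw [Finset.filter_false_of_mem, Finset.card_empty, Nat.factorial_zero]
    exact fun i hi h => hm (mem_image.2 ⟨i, hi, h⟩)

/-- If `ν` is a rearrangement of `μ`, it is one in `m(μ)!` ways. -/
theorem card_rearrangements {r : ℕ} (μ : Fin r → ℕ) (hpos : ∀ i, 0 < μ i)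
    (w : Equiv.Perm (Fin r)) :
    #{π : Equiv.Perm (Fin r) | ∀ i, μ (w i) = (μ ∘ π) i} = multFactorial μ := by
  rw [multFactorial_eq_card μ hpos]
  refine Finset.card_bij (fun π _ => π * w⁻¹) ?_ ?_ ?_
  · intro π hπ
    rw [mem_filter] at hπ ⊢
    refine ⟨mem_univ _, funext fun i => ?_⟩
    simpa [Equiv.Perm.inv_def] using (hπ.2 (w.symm i)).symm
  · intro π _ π' _ h
    exact mul_right_cancel h
  · intro σ hσ
    rw [mem_filter] at hσ
    refine ⟨σ * w, ?_, by simp⟩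
    rw [mem_filter]
    exact ⟨mem_univ _, fun i => (congrFun hσ.2 (w i)).symm⟩

theorem sum_tilingsOfSizes {r : ℕ} (μ : Fin r → ℕ) (hpos : ∀ i, 0 < μ i) {M : Type*}
    [AddCommMonoid M] (F : MonotonicRibbonTiling r → M) :
    ∑ π : Equiv.Perm (Fin r), ∑ T ∈ tilingsOfSizes (μ ∘ π), F T =
      multFactorial μ • ∑ T ∈ tilings μ, F T := by
  have h (π : Equiv.Perm (Fin r)) : tilingsOfSizes (μ ∘ π) =
      (tilings μ).filter fun T => ∀ i, #(T.ribbon i) = (μ ∘ π) i := by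
    ext T
    rw [mem_tilingsOfSizes, mem_filter, tilings, Set.Finite.mem_toFinset]
    exact ⟨fun h => ⟨⟨π, h⟩, h⟩, fun h => h.2⟩
  simp only [h, Finset.sum_filter]
  rw [Finset.sum_comm, Finset.smul_sum]
  refine Finset.sum_congr rfl fun T hT => ?_
  rw [tilings, Set.Finite.mem_toFinset] at hT
  obtain ⟨w, hw⟩ := hT
  simp only [hw]
  rw [← Finset.sum_filter, Finset.sum_const, card_rearrangements μ hpos w]

/-- The path Murnaghan–Nakayama rule for Schur polynomials. -/
theorem pathPoly_eq_sum_tilings {r N : ℕ} (μ : Fin r → ℕ) (hpos : ∀ i, 0 < μ i)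
    (hN : ∑ i, μ i ≤ N) :
    pathPoly N μ = multFactorial μ • ∑ T ∈ tilings μ, T.sign • schurPoly N T.shape := by
  have hbot : shiftedParts N ⊥ = staircase N := by
    funext j
    rw [shiftedParts, rowLen_eq_zero, zero_add]
    refine le_of_eq_of_le ?_ (Nat.zero_le _)
    rw [YoungDiagram.colLen_eq_card]
    rfl
  refine mul_left_cancel₀ (alternant_staircase_ne_zero N) ?_
  rw [alternant_mul_pathPoly, ← hbot, wordAlternant_eq_sum_ribbonSum μ hpos, hbot,
    mul_smul_comm, Finset.mul_sum, ← sum_tilingsOfSizes μ hpos]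
  refine Finset.sum_congr rfl fun π _ => ?_
  have hsum : ∑ i, (μ ∘ π) i ≤ N := (Equiv.sum_comp π μ).trans_le hN
  rw [← List.append_nil (List.ofFn (μ ∘ π)), ribbonSum_ofFn_append N _ hsum]
  refine Finset.sum_congr rfl fun T _ => ?_
  rw [mul_smul_comm, alternant_mul_schurPoly, ribbonSum]

end

end PathMN

theorem mainTheorem1 {r : ℕ} (μ : Fin r → ℕ) (hμ : Antitone μ) (hpos : ∀ i, 0 < μ i) :
    PathMN.pathPowerSum μ =
        ∑ σ : Equiv.Perm (Fin r), ∏ C ∈ PathMN.permCycles σ, PathMN.powerSum (∑ i ∈ C, μ i) ∧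
      PathMN.pathPowerSum μ =
        PathMN.multFactorial μ •
          ∑ T ∈ PathMN.tilings μ, T.sign • PathMN.schurFunction T.shape := by
  have h (N : ℕ) : PathMN.AgreesWith N (PathMN.pathPowerSum μ) (PathMN.pathPoly N μ) :=
    PathMN.agreesWith_atomic N μ hpos _ (PathMN.pathPartialPerm_isDisjointPaths μ)
  constructor
  · exact PathMN.eq_of_agreesWith 0 fun N _ =>
      ⟨_, h N, PathMN.agreesWith_sum_permCycles N μ hpos⟩
  · refine PathMN.eq_of_agreesWith (∑ i, μ i) fun N hN => ⟨_, h N, ?_⟩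
    rw [PathMN.pathPoly_eq_sum_tilings μ hpos hN]
    refine (PathMN.AgreesWith.sum fun T hT => ?_).nsmul _
    refine (PathMN.AgreesWith.schurFunction (T.colLen_shape_le.trans ?_)).zsmul _
    rw [PathMN.tilings, Set.Finite.mem_toFinset] at hT
    obtain ⟨w, hw⟩ := hT
    exact (Finset.sum_congr rfl fun i _ => hw i).trans_le ((Equiv.sum_comp w μ).trans_le hN)
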